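/- **Theorem 3.1 (generation / well-posedness).** Let $l_0<l_1<l_2<l_3$ be real numbers, $I_j=(l_{j-1},l_j)$ for $j=1,2,3$, and let $\rho_1,\rho_2,\beta\ge 0$. All functions are complex-valued, and derivatives in $x$ are weak (distributional) derivatives. Put $$H^2_{l_0}=\{u\in H^2(I_1): u(l_0)=u'(l_0)=0\},\qquad H^2_{l_3}=\{w\in H^2(I_3): w(l_3)=w'(l_3)=0\},$$ $$\mathbb H=\{(u,v,w)\in H^2_{l_0}\times H^1(I_2)\times H^2_{l_3}: u(l_1)=v(l_1),\ v(l_2)=w(l_2)\},\qquad \mathbb L=L^2(I_1)\times L^2(I_2)\times L^2(I_3),$$ where $\mathbb H$ carries the inner product $\langle u'',\tilde u''\rangle_{L^2(I_1)}+\langle v',\tilde v'\rangle_{L^2(I_2)}+\langle w'',\tilde w''\rangle_{L^2(I_3)}$ and $\mathbb L$ the sum of the three $L^2$ inner products; let $\mathcal H=\mathbb H\times\mathbb L$ with the sum inner product. Inner products are linear in the first argument. For $U=(u_1,v_1,w_1,u_2,v_2,w_2)\in\mathbb H\times\mathbb H$ with $u_1^{(4)}\in L^2(I_1)$, $v_1''\in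 L^2(I_2)$, $w_1^{(4)}\in L^2(I_3)$ put $$AU=\big(u_2,\;v_2,\;w_2,\;-u_1^{(4)}+\rho_1u_2'',\;v_1''-\beta v_2,\;-w_1^{(4)}+\rho_2w_2''\big)\in\mathcal H,$$ and say that $U$ satisfies the transmission conditions in the weak sense if, for all $\tilde U=(\tilde u_1,\tilde v_1,\tilde w_1,\tilde u_2,\tilde v_2,\tilde w_2)\in\mathbb H\times\mathbb H$, $$\begin{aligned}\langle AU,\tilde U\rangle_{\mathcal H}={}&\langle u_2'',\tilde u_1''\rangle+\langle v_2',\tilde v_1'\rangle+\langle w_2'',\tilde w_1''\rangle-\langle u_1'',\tilde u_2''\rangle-\rho_1\langle u_2',\tilde u_2'\rangle\\&-\beta\langle v_2,\tilde v_2\rangle-\langle v_1',\tilde v_2'\rangle-\langle w_1'',\tilde w_2''\rangle-\rho_2\langle w_2',\tilde w_2'\rangle,\end{aligned}$$ with the $L^2$ inner products of the respective intervals on the right. Let $\mathcal A:D(\mathcal A)\subset\mathcal H\to\mathcal H$, $\mathcal AU=AU$, where $D(\mathcal A)$ is the set of all such $U$ (with $u_1^{(4)},v_1'',w_1^{(4)}$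 square integrable) that satisfy the transmission conditions in the weak sense. Then $\mathcal H$ is a Hilbert space, and $\mathcal A$ is the infinitesimal generator of a $C_0$-semigroup $(S(t))_{t\ge 0}$ of contractions on $\mathcal H$. In consequence, for each $U_0\in D(\mathcal A)$ the Cauchy problem $$\frac{dU}{dt}(t)=\mathcal AU(t)\quad(t>0),\qquad U(0)=U_0$$ has a unique classical solution on $[0,\infty)$, that is, a unique function $U$ that is continuous on $[0,\infty)$, continuously differentiable on $(0,\infty)$, takes values in $D(\mathcal A)$ for $t>0$ and satisfies the problem. This solution belongs to $C^1([0,\infty),\mathcal H)$, is given by $U(t)=S(t)U_0$, and depends continuously on the initial data: if $U,V$ are the classical solutions with initial values $U_0,V_0\in D(\mathcal A)$, then $\|U(t)-V(t)\|_{\mathcal H}\le\|U_0-V_0\|_{\mathcal H}$ for all $t\ge 0$. -/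

import Mathlib

open Set Filter Topology MeasureTheory
open scoped NNReal ContDiff

noncomputable section

namespace BeamString

/-! ### Weak derivatives and boundary values on a bounded interval -/

/-- The complex Lebesgue space on the open interval from `a` to `b`. -/
abbrev L2 (a b : ℝ) : Type := Lp ℂ 2 (volume.restrict (Ioo a b))

/-- Smooth functions with compact support inside the open interval.  Real-valued test functions
give the same weak derivatives as complex-valued ones. -/
def IsTest (a b : ℝ) (φ : ℝ → ℝ) : Prop :=
  ContDiff ℝ ∞ φ ∧ HasCompactSupport φ ∧ tsupport φ ⊆ Ioo a b

/-- The distributional derivative of order `n` of `f` on the interval is the function `g`. -/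
def IsWeakDeriv {a b : ℝ} (n : ℕ) (f g : L2 a b) : Prop :=
  ∀ φ : ℝ → ℝ, IsTest a b φ →
    ∫ x in Ioo a b, iteratedDeriv n φ x • f x = (-1) ^ n * ∫ x in Ioo a b, φ x • g x

open Classical in
/-- The weak derivative of order `n`, for those `f` which have one in the Lebesgue space
(it is then unique); zero otherwise. -/
def weakDeriv {a b : ℝ} (n : ℕ) (f : L2 a b) : L2 a b :=
  if h : ∃ g : L2 a b, IsWeakDeriv n f g then h.choose else 0

/-- The value at the point `x` of the closed interval of the continuous representative of `f`
is `c`. -/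
def HasTrace {a b : ℝ} (f : L2 a b) (x : ℝ) (c : ℂ) : Prop :=
  ∃ F : ℝ → ℂ, ContinuousOn F (Icc a b) ∧ f =ᵐ[volume.restrict (Ioo a b)] F ∧ F x = c

lemma integrable_smul_of_continuous {a b : ℝ} (f : L2 a b) {ψ : ℝ → ℝ} (hψ : Continuous ψ)
    (hc : HasCompactSupport ψ) :
    Integrable (fun x => ψ x • f x) (volume.restrict (Ioo a b)) := by
  have hf : Integrable f (volume.restrict (Ioo a b)) :=
    (Lp.memLp f).integrable (by norm_num)
  obtain ⟨C, hC⟩ := hψ.bounded_above_of_compact_support hc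
  exact hf.bdd_smul C hψ.aestronglyMeasurable (ae_of_all _ hC)

lemma IsTest.iteratedDeriv {a b : ℝ} {φ : ℝ → ℝ} (h : IsTest a b φ) (n : ℕ) :
    IsTest a b (iteratedDeriv n φ) := by
  induction n with
  | zero => simpa using h
  | succ n ih =>
    rw [iteratedDeriv_succ]
    refine ⟨?_, ih.2.1.deriv, ?_⟩
    · exact (contDiff_infty_iff_deriv.1 ih.1).2
    · exact (tsupport_deriv_subset).trans ih.2.2

lemma IsTest.integrable {a b : ℝ} {φ : ℝ → ℝ} (h : IsTest a b φ) (f : L2 a b) :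
    Integrable (fun x => φ x • f x) (volume.restrict (Ioo a b)) :=
  integrable_smul_of_continuous f h.1.continuous h.2.1

lemma IsWeakDeriv.add {a b : ℝ} {n : ℕ} {f₁ f₂ g₁ g₂ : L2 a b} (h₁ : IsWeakDeriv n f₁ g₁)
    (h₂ : IsWeakDeriv n f₂ g₂) : IsWeakDeriv n (f₁ + f₂) (g₁ + g₂) := by
  intro φ hφ
  have e₁ : ∫ x in Ioo a b, iteratedDeriv n φ x • (f₁ + f₂ : L2 a b) x
      = ∫ x in Ioo a b, (iteratedDeriv n φ x • f₁ x + iteratedDeriv n φ x • f₂ x) := by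
    refine integral_congr_ae ?_
    filter_upwards [Lp.coeFn_add f₁ f₂] with x hx
    rw [hx, Pi.add_apply, smul_add]
  have e₂ : ∫ x in Ioo a b, φ x • (g₁ + g₂ : L2 a b) x
      = ∫ x in Ioo a b, (φ x • g₁ x + φ x • g₂ x) := by
    refine integral_congr_ae ?_
    filter_upwards [Lp.coeFn_add g₁ g₂] with x hx
    rw [hx, Pi.add_apply, smul_add]
  rw [e₁, e₂, integral_add ((hφ.iteratedDeriv n).integrable _) ((hφ.iteratedDeriv n).integrable _),
    integral_add (hφ.integrable _) (hφ.integrable _), h₁ φ hφ, h₂ φ hφ, mul_add]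

lemma IsWeakDeriv.smul {a b : ℝ} {n : ℕ} {f g : L2 a b} (c : ℂ) (h : IsWeakDeriv n f g) :
    IsWeakDeriv n (c • f) (c • g) := by
  intro φ hφ
  have e₁ : ∫ x in Ioo a b, iteratedDeriv n φ x • (c • f : L2 a b) x
      = ∫ x in Ioo a b, c • (iteratedDeriv n φ x • f x) := by
    refine integral_congr_ae ?_
    filter_upwards [Lp.coeFn_smul c f] with x hx
    rw [hx, Pi.smul_apply, smul_comm]
  have e₂ : ∫ x in Ioo a b, φ x • (c • g : L2 a b) x
      = ∫ x in Ioo a b, c • (φ x • g x) := by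
    refine integral_congr_ae ?_
    filter_upwards [Lp.coeFn_smul c g] with x hx
    rw [hx, Pi.smul_apply, smul_comm]
  rw [e₁, e₂, integral_smul, integral_smul, h φ hφ, smul_eq_mul, smul_eq_mul]
  ring

lemma isWeakDeriv_zero_zero {a b : ℝ} (n : ℕ) : IsWeakDeriv n (0 : L2 a b) 0 := by
  intro φ hφ
  have e : ∀ ψ : ℝ → ℝ, ∫ x in Ioo a b, ψ x • (0 : L2 a b) x = 0 := by
    intro ψ
    refine integral_eq_zero_of_ae ?_
    filter_upwards [Lp.coeFn_zero ℂ 2 (volume.restrict (Ioo a b))] with x hx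
    rw [hx, Pi.zero_apply, smul_zero]
  rw [e, e, mul_zero]

lemma ae_eq_of_test {a b : ℝ} {f g : ℝ → ℂ} (hf : Integrable f (volume.restrict (Ioo a b)))
    (hg : Integrable g (volume.restrict (Ioo a b)))
    (h : ∀ φ : ℝ → ℝ, IsTest a b φ →
      ∫ x in Ioo a b, φ x • f x = ∫ x in Ioo a b, φ x • g x) :
    f =ᵐ[volume.restrict (Ioo a b)] g := by
  have hfg : IntegrableOn (f - g) (Ioo a b) := hf.sub hg
  have key := isOpen_Ioo.ae_eq_zero_of_integral_contDiff_smul_eq_zero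
    (μ := (volume : Measure ℝ)) (U := Ioo a b) (f := f - g) hfg.locallyIntegrableOn (by
      intro φ h1 h2 h3
      have hφ : IsTest a b φ := ⟨h1, h2, h3⟩
      have hs : ∫ x, φ x • (f - g) x = ∫ x in Ioo a b, φ x • (f - g) x := by
        refine (setIntegral_eq_integral_of_forall_compl_eq_zero ?_).symm
        intro x hx
        rw [image_eq_zero_of_notMem_tsupport (fun hx' => hx (h3 hx')), zero_smul]
      obtain ⟨C, hC⟩ := h1.continuous.bounded_above_of_compact_support h2
      have i1 : Integrable (fun x => φ x • f x) (volume.restrict (Ioo a b)) := hf.bdd_smul C h1.continuous.aestronglyMeasurable (ae_of_all _ hC)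
      have i2 : Integrable (fun x => φ x • g x) (volume.restrict (Ioo a b)) := hg.bdd_smul C h1.continuous.aestronglyMeasurable (ae_of_all _ hC)
      rw [hs]
      have hd : ∫ x in Ioo a b, φ x • (f - g) x
          = (∫ x in Ioo a b, φ x • f x) - ∫ x in Ioo a b, φ x • g x := by
        rw [← integral_sub i1 i2]
        simp only [Pi.sub_apply, smul_sub]
      rw [hd, h φ hφ, sub_self])
  rw [Filter.EventuallyEq, ae_restrict_iff' measurableSet_Ioo]
  filter_upwards [key] with x hx hmem
  exact sub_eq_zero.1 (hx hmem)

lemma L2.integrable {a b : ℝ} (f : L2 a b) : Integrable f (volume.restrict (Ioo a b)) :=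
  (Lp.memLp f).integrable (by norm_num)

lemma IsWeakDeriv.unique {a b : ℝ} {n : ℕ} {f g₁ g₂ : L2 a b} (h₁ : IsWeakDeriv n f g₁)
    (h₂ : IsWeakDeriv n f g₂) : g₁ = g₂ := by
  refine Lp.ext (ae_eq_of_test g₁.integrable g₂.integrable fun φ hφ => ?_)
  have h := (h₁ φ hφ).symm.trans (h₂ φ hφ)
  exact mul_left_cancel₀ (pow_ne_zero n (by norm_num)) h

lemma weakDeriv_spec {a b : ℝ} {n : ℕ} {f : L2 a b} (h : ∃ g, IsWeakDeriv n f g) :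
    IsWeakDeriv n f (weakDeriv n f) := by
  rw [weakDeriv, dif_pos h]
  exact h.choose_spec

lemma IsWeakDeriv.weakDeriv_eq {a b : ℝ} {n : ℕ} {f g : L2 a b} (h : IsWeakDeriv n f g) :
    weakDeriv n f = g :=
  (weakDeriv_spec ⟨g, h⟩).unique h

lemma weakDeriv_add {a b : ℝ} {n : ℕ} {f₁ f₂ : L2 a b} (h₁ : ∃ g, IsWeakDeriv n f₁ g)
    (h₂ : ∃ g, IsWeakDeriv n f₂ g) :
    weakDeriv n (f₁ + f₂) = weakDeriv n f₁ + weakDeriv n f₂ :=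
  ((weakDeriv_spec h₁).add (weakDeriv_spec h₂)).weakDeriv_eq

lemma weakDeriv_smul {a b : ℝ} {n : ℕ} {f : L2 a b} (c : ℂ) (h : ∃ g, IsWeakDeriv n f g) :
    weakDeriv n (c • f) = c • weakDeriv n f :=
  ((weakDeriv_spec h).smul c).weakDeriv_eq

lemma HasTrace.add {a b x : ℝ} {f₁ f₂ : L2 a b} {c₁ c₂ : ℂ} (h₁ : HasTrace f₁ x c₁)
    (h₂ : HasTrace f₂ x c₂) : HasTrace (f₁ + f₂) x (c₁ + c₂) := by
  obtain ⟨F₁, k₁, e₁, v₁⟩ := h₁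
  obtain ⟨F₂, k₂, e₂, v₂⟩ := h₂
  refine ⟨F₁ + F₂, k₁.add k₂, ?_, by rw [Pi.add_apply, v₁, v₂]⟩
  exact (Lp.coeFn_add f₁ f₂).trans (e₁.add e₂)

lemma HasTrace.smul {a b x : ℝ} {f : L2 a b} {c : ℂ} (d : ℂ) (h : HasTrace f x c) :
    HasTrace (d • f) x (d * c) := by
  obtain ⟨F, k, e, v⟩ := h
  refine ⟨d • F, k.const_smul d, ?_, by rw [Pi.smul_apply, v, smul_eq_mul]⟩
  exact (Lp.coeFn_smul d f).trans (e.const_smul d)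

lemma hasTrace_zero {a b : ℝ} (x : ℝ) : HasTrace (0 : L2 a b) x 0 :=
  ⟨0, continuousOn_const, Lp.coeFn_zero ℂ 2 _, rfl⟩

/-- The trace of a function which is constant almost everywhere is that constant. -/
lemma HasTrace.eq_of_ae_const {a b x : ℝ} (hab : a < b) (hx : x ∈ Icc a b) {f : L2 a b} {c d : ℂ}
    (h : HasTrace f x c) (hd : f =ᵐ[volume.restrict (Ioo a b)] fun _ => d) : c = d := by
  obtain ⟨F, k, e, v⟩ := h
  have h1 : F =ᵐ[volume.restrict (Ioo a b)] fun _ => d := e.symm.trans hd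
  have h2 : EqOn F (fun _ => d) (Ioo a b) :=
    Measure.eqOn_open_of_ae_eq h1 isOpen_Ioo (k.mono Ioo_subset_Icc_self) continuousOn_const
  have h3 : EqOn F (fun _ => d) (Icc a b) :=
    h2.of_subset_closure k continuousOn_const Ioo_subset_Icc_self
      (by rw [closure_Ioo hab.ne])
  rw [← v]
  exact h3 hx

/-- A function whose weak derivative vanishes on an interval is constant. -/
lemma ae_const_of_isWeakDeriv_zero {a b : ℝ} (hab : a < b) {f : L2 a b}
    (h : IsWeakDeriv 1 f 0) : ∃ c : ℂ, f =ᵐ[volume.restrict (Ioo a b)] fun _ => c := by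
  obtain ⟨ψ, hψ, hψ1⟩ : ∃ ψ : ℝ → ℝ, IsTest a b ψ ∧ ∫ x in Ioo a b, ψ x = 1 := by
    let B : ContDiffBump ((a + b) / 2) :=
      ⟨(b - a) / 8, (b - a) / 4, by linarith, by linarith⟩
    have hsub : tsupport (B.normed volume) ⊆ Ioo a b := by
      rw [B.tsupport_normed_eq, Real.closedBall_eq_Icc]
      intro x hx
      have h1 : B.rOut = (b - a) / 4 := rfl
      rw [h1] at hx
      exact ⟨by linarith [hx.1], by linarith [hx.2]⟩
    refine ⟨B.normed volume, ⟨B.contDiff_normed, B.hasCompactSupport_normed, hsub⟩, ?_⟩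
    rw [setIntegral_eq_integral_of_forall_compl_eq_zero, B.integral_normed]
    intro x hx
    exact image_eq_zero_of_notMem_tsupport (fun hx' => hx (hsub hx'))
  refine ⟨∫ x in Ioo a b, ψ x • f x, ae_eq_of_test f.integrable (integrable_const _) ?_⟩
  intro φ hφ
  set m : ℝ := ∫ x in Ioo a b, φ x with hm
  set θ : ℝ → ℝ := fun x => φ x - m * ψ x with hθ
  have hθc : ContDiff ℝ ∞ θ := hφ.1.sub (contDiff_const.mul hψ.1)
  have hφz : ∀ x ∉ Ioo a b, φ x = 0 := fun x hx =>
    image_eq_zero_of_notMem_tsupport (fun hx' => hx (hφ.2.2 hx'))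
  have hψz : ∀ x ∉ Ioo a b, ψ x = 0 := fun x hx =>
    image_eq_zero_of_notMem_tsupport (fun hx' => hx (hψ.2.2 hx'))
  have hφi : IntegrableOn φ (Ioo a b) :=
    (hφ.1.continuous.integrable_of_hasCompactSupport hφ.2.1).integrableOn
  have hψi : IntegrableOn ψ (Ioo a b) :=
    (hψ.1.continuous.integrable_of_hasCompactSupport hψ.2.1).integrableOn
  have hθ0 : ∫ x in a..b, θ x = 0 := by
    rw [intervalIntegral.integral_of_le hab.le, integral_Ioc_eq_integral_Ioo]
    rw [hθ, integral_sub hφi (hψi.const_mul m), integral_const_mul, hψ1]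
    simp [hm]
  -- a compact interval inside the open one which carries both test functions
  obtain ⟨a', b', ha', hb', hsupp⟩ : ∃ a' b', a < a' ∧ b' < b ∧
      ∀ x, x ∉ Icc a' b' → θ x = 0 := by
    have hK : IsCompact (tsupport φ ∪ tsupport ψ) :=
      hφ.2.1.isCompact.union hψ.2.1.isCompact
    have hKs : tsupport φ ∪ tsupport ψ ⊆ Ioo a b := union_subset hφ.2.2 hψ.2.2
    have hne : (tsupport φ ∪ tsupport ψ).Nonempty := by
      by_contra hemp
      rw [not_nonempty_iff_eq_empty, union_empty_iff] at hemp
      have : ψ = 0 := by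
        funext x
        exact image_eq_zero_of_notMem_tsupport (by rw [hemp.2]; exact notMem_empty x)
      rw [this] at hψ1
      simp at hψ1
    obtain ⟨p, hp, hpl⟩ := hK.exists_isLeast hne
    obtain ⟨q, hq, hql⟩ := hK.exists_isGreatest hne
    refine ⟨p, q, (hKs hp).1, (hKs hq).2, ?_⟩
    intro x hx
    have hxK : x ∉ tsupport φ ∪ tsupport ψ := fun hxK => hx ⟨hpl hxK, hql hxK⟩
    rw [mem_union, not_or] at hxK
    simp [hθ, image_eq_zero_of_notMem_tsupport hxK.1, image_eq_zero_of_notMem_tsupport hxK.2]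
  set Θ : ℝ → ℝ := fun x => ∫ t in a..x, θ t with hΘ
  have hder : ∀ x, HasDerivAt Θ (θ x) x := fun x =>
    intervalIntegral.integral_hasDerivAt_right (hθc.continuous.intervalIntegrable _ _)
      (hθc.continuous.stronglyMeasurableAtFilter _ _) hθc.continuous.continuousAt
  have hderiv : deriv Θ = θ := funext fun x => (hder x).deriv
  have hΘc : ContDiff ℝ ∞ Θ := by
    rw [contDiff_infty_iff_deriv]
    exact ⟨fun x => (hder x).differentiableAt, by rw [hderiv]; exact hθc⟩
  have hΘz : ∀ x, x ∉ Icc a' b' → Θ x = 0 := by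
    intro x hx
    rw [mem_Icc, not_and_or, not_le, not_le] at hx
    rcases hx with hx | hx
    · simp only [hΘ]
      refine intervalIntegral.integral_zero_ae (ae_of_all _ fun t ht => hsupp t ?_)
      intro ht'
      have := ht.2
      rcases le_max_iff.1 this with h1 | h1
      · linarith [ht'.1]
      · linarith [ht'.1]
    · have h2 : ∫ t in x..b, θ t = 0 := by
        refine intervalIntegral.integral_zero_ae (ae_of_all _ fun t ht => hsupp t ?_)
        intro ht'
        rcases min_lt_iff.1 ht.1 with h1 | h1
        · linarith [ht'.2]
        · linarith [ht'.2]
      have h3 := intervalIntegral.integral_add_adjacent_intervals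
        (hθc.continuous.intervalIntegrable (μ := volume) a x)
        (hθc.continuous.intervalIntegrable x b)
      rw [h2, hθ0, add_zero] at h3
      exact h3
  have hΘs : tsupport Θ ⊆ Icc a' b' := by
    refine closure_minimal (fun x hx => ?_) isClosed_Icc
    by_contra hx'
    exact hx (hΘz x hx')
  have hΘt : IsTest a b Θ :=
    ⟨hΘc, isCompact_Icc.of_isClosed_subset (isClosed_tsupport _) hΘs,
      hΘs.trans fun x hx => ⟨ha'.trans_le hx.1, hx.2.trans_lt hb'⟩⟩
  have h0 : ∫ x in Ioo a b, Θ x • (0 : L2 a b) x = 0 := by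
    refine integral_eq_zero_of_ae ?_
    filter_upwards [Lp.coeFn_zero ℂ 2 (volume.restrict (Ioo a b))] with x hx
    rw [hx, Pi.zero_apply, smul_zero]
  have h1 := h Θ hΘt
  rw [h0, mul_zero, iteratedDeriv_one, hderiv] at h1
  have h2 : ∫ x in Ioo a b, θ x • f x
      = (∫ x in Ioo a b, φ x • f x) - m • ∫ x in Ioo a b, ψ x • f x := by
    have i2 : Integrable (fun x => m • (ψ x • f x)) (volume.restrict (Ioo a b)) :=
      (hψ.integrable f).smul m
    rw [← integral_smul, ← integral_sub (hφ.integrable f) i2]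
    refine integral_congr_ae (ae_of_all _ fun x => ?_)
    simp only [hθ, sub_smul, mul_smul]
  rw [h2, sub_eq_zero] at h1
  rw [h1, integral_smul_const]

/-- The Sobolev space of order `k` on the open interval. -/
def sobolev (a b : ℝ) (k : ℕ) : Submodule ℂ (L2 a b) where
  carrier := {f | ∀ n ≤ k, ∃ g, IsWeakDeriv n f g}
  zero_mem' := fun n _ => ⟨0, isWeakDeriv_zero_zero n⟩
  add_mem' := fun {f g} hf hg n hn => by
    obtain ⟨p, hp⟩ := hf n hn
    obtain ⟨q, hq⟩ := hg n hn
    exact ⟨p + q, hp.add hq⟩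
  smul_mem' := fun c f hf n hn => by
    obtain ⟨p, hp⟩ := hf n hn
    exact ⟨c • p, hp.smul c⟩

/-- The functions in the second order Sobolev space which vanish at the point `x` together with
their first derivative. -/
def clamped (a b x : ℝ) : Submodule ℂ (L2 a b) where
  carrier := {f | f ∈ sobolev a b 2 ∧ HasTrace f x 0 ∧ HasTrace (weakDeriv 1 f) x 0}
  zero_mem' := ⟨zero_mem _, hasTrace_zero x, by
    rw [(isWeakDeriv_zero_zero 1).weakDeriv_eq]; exact hasTrace_zero x⟩
  add_mem' := fun {f g} hf hg => by
    refine ⟨add_mem hf.1 hg.1, by simpa using hf.2.1.add hg.2.1, ?_⟩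
    rw [weakDeriv_add (hf.1 1 (by norm_num)) (hg.1 1 (by norm_num))]
    simpa using hf.2.2.add hg.2.2
  smul_mem' := fun c f hf => by
    refine ⟨Submodule.smul_mem _ c hf.1, by simpa using hf.2.1.smul c, ?_⟩
    rw [weakDeriv_smul c (hf.1 1 (by norm_num))]
    simpa using hf.2.2.smul c

lemma eq_zero_of_clamped {a b x : ℝ} (hab : a < b) (hx : x ∈ Icc a b) {f : L2 a b}
    (hf : f ∈ clamped a b x) (h : weakDeriv 2 f = 0) : f = 0 := by
  have h1 := weakDeriv_spec (hf.1 1 (by norm_num))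
  have h2 := weakDeriv_spec (hf.1 2 le_rfl)
  rw [h] at h2
  have h3 : IsWeakDeriv 1 (weakDeriv 1 f) 0 := by
    intro φ hφ
    have e1 := h1 _ (hφ.iteratedDeriv 1)
    have e2 := h2 φ hφ
    have e3 : iteratedDeriv 1 (iteratedDeriv 1 φ) = iteratedDeriv 2 φ := by
      rw [iteratedDeriv_one, iteratedDeriv_one, iteratedDeriv_succ, iteratedDeriv_one]
    rw [e3, e2] at e1
    rw [pow_two, neg_one_mul, neg_neg, one_mul] at e1
    rw [e1]; ring
  obtain ⟨c, hc⟩ := ae_const_of_isWeakDeriv_zero hab h3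
  have hc0 := hf.2.2.eq_of_ae_const hab hx hc
  subst hc0
  have h4 : weakDeriv 1 f = 0 := Lp.ext (hc.trans (Lp.coeFn_zero ℂ 2 _).symm)
  rw [h4] at h1
  obtain ⟨d, hd⟩ := ae_const_of_isWeakDeriv_zero hab h1
  have hd0 := hf.2.1.eq_of_ae_const hab hx hd
  subst hd0
  exact Lp.ext (hd.trans (Lp.coeFn_zero ℂ 2 _).symm)

/-! ### The spaces of the beam-string-beam system -/

/-- The end points of the three consecutive intervals occupied by beam, string and beam. -/
structure Geometry where
  l₀ : ℝ
  l₁ : ℝ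
  l₂ : ℝ
  l₃ : ℝ
  h₀₁ : l₀ < l₁
  h₁₂ : l₁ < l₂
  h₂₃ : l₂ < l₃

/-- The triples `(u, v, w)` of displacements: clamped at the outer ends, continuous across the
two interfaces. -/
def dispSubmodule (G : Geometry) :
    Submodule ℂ (L2 G.l₀ G.l₁ × L2 G.l₁ G.l₂ × L2 G.l₂ G.l₃) where
  carrier := {y | y.1 ∈ clamped G.l₀ G.l₁ G.l₀ ∧ y.2.1 ∈ sobolev G.l₁ G.l₂ 1 ∧
    y.2.2 ∈ clamped G.l₂ G.l₃ G.l₃ ∧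
    (∃ c, HasTrace y.1 G.l₁ c ∧ HasTrace y.2.1 G.l₁ c) ∧
    (∃ c, HasTrace y.2.1 G.l₂ c ∧ HasTrace y.2.2 G.l₂ c)}
  zero_mem' := ⟨zero_mem _, zero_mem _, zero_mem _, ⟨0, hasTrace_zero _, hasTrace_zero _⟩,
    ⟨0, hasTrace_zero _, hasTrace_zero _⟩⟩
  add_mem' := by
    rintro y z ⟨hu, hv, hw, ⟨c, c1, c2⟩, ⟨d, d1, d2⟩⟩ ⟨hu', hv', hw', ⟨c', c1', c2'⟩, ⟨d', d1', d2'⟩⟩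
    exact ⟨add_mem hu hu', add_mem hv hv', add_mem hw hw', ⟨_, c1.add c1', c2.add c2'⟩,
      ⟨_, d1.add d1', d2.add d2'⟩⟩
  smul_mem' := by
    rintro k y ⟨hu, hv, hw, ⟨c, c1, c2⟩, ⟨d, d1, d2⟩⟩
    exact ⟨Submodule.smul_mem _ k hu, Submodule.smul_mem _ k hv, Submodule.smul_mem _ k hw,
      ⟨_, c1.smul k, c2.smul k⟩, ⟨_, d1.smul k, d2.smul k⟩⟩

/-- The displacement space `ℍ`, a type of its own because its norm is the energy norm and not the
norm of the ambient product. -/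
def Disp (G : Geometry) : Type := ↥(dispSubmodule G)

instance (G : Geometry) : AddCommGroup (Disp G) :=
  inferInstanceAs (AddCommGroup ↥(dispSubmodule G))

instance (G : Geometry) : Module ℂ (Disp G) :=
  inferInstanceAs (Module ℂ ↥(dispSubmodule G))

namespace Disp

variable {G : Geometry}

/-- The displacement of the left beam. -/
def u : Disp G →ₗ[ℂ] L2 G.l₀ G.l₁ :=
  LinearMap.fst ℂ _ _ ∘ₗ (dispSubmodule G).subtype

/-- The displacement of the string. -/
def v : Disp G →ₗ[ℂ] L2 G.l₁ G.l₂ :=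
  LinearMap.fst ℂ _ _ ∘ₗ LinearMap.snd ℂ _ _ ∘ₗ (dispSubmodule G).subtype

/-- The displacement of the right beam. -/
def w : Disp G →ₗ[ℂ] L2 G.l₂ G.l₃ :=
  LinearMap.snd ℂ _ _ ∘ₗ LinearMap.snd ℂ _ _ ∘ₗ (dispSubmodule G).subtype

lemma u_mem (Y : Disp G) : u Y ∈ clamped G.l₀ G.l₁ G.l₀ := Y.2.1

lemma v_mem (Y : Disp G) : v Y ∈ sobolev G.l₁ G.l₂ 1 := Y.2.2.1

lemma w_mem (Y : Disp G) : w Y ∈ clamped G.l₂ G.l₃ G.l₃ := Y.2.2.2.1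

lemma ext {Y Z : Disp G} (hu : u Y = u Z) (hv : v Y = v Z) (hw : w Y = w Z) : Y = Z :=
  Subtype.ext (Prod.ext hu (Prod.ext hv hw))

lemma eq_zero {Y : Disp G} (hu : weakDeriv 2 (u Y) = 0) (hv : weakDeriv 1 (v Y) = 0)
    (hw : weakDeriv 2 (w Y) = 0) : Y = 0 := by
  have hu0 := eq_zero_of_clamped G.h₀₁ (left_mem_Icc.2 G.h₀₁.le) (u_mem Y) hu
  have hw0 := eq_zero_of_clamped G.h₂₃ (right_mem_Icc.2 G.h₂₃.le) (w_mem Y) hw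
  have h1 := weakDeriv_spec (v_mem Y 1 le_rfl)
  rw [hv] at h1
  obtain ⟨d, hd⟩ := ae_const_of_isWeakDeriv_zero G.h₁₂ h1
  obtain ⟨c, c1, c2⟩ := Y.2.2.2.2.1
  have c2' : HasTrace (v Y) G.l₁ c := c2
  have c1' : HasTrace (u Y) G.l₁ c := c1
  have hc : c = 0 := c1'.eq_of_ae_const G.h₀₁ (right_mem_Icc.2 G.h₀₁.le)
    (by rw [hu0]; exact Lp.coeFn_zero ℂ 2 _)
  have hcd : c = d := c2'.eq_of_ae_const G.h₁₂ (left_mem_Icc.2 G.h₁₂.le) hd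
  rw [← hcd, hc] at hd
  have hv0 : v Y = 0 := Lp.ext (hd.trans (Lp.coeFn_zero ℂ 2 _).symm)
  exact ext (by rw [hu0, map_zero]) (by rw [hv0, map_zero]) (by rw [hw0, map_zero])

/-- The energy inner product `⟨u'', ũ''⟩ + ⟨v', ṽ'⟩ + ⟨w'', w̃''⟩`. As everywhere in Mathlib,
`inner` is conjugate linear in its first argument. -/
@[reducible] def core (G : Geometry) : InnerProductSpace.Core ℂ (Disp G) where
  inner Y Z := inner ℂ (weakDeriv 2 (u Y)) (weakDeriv 2 (u Z))
    + inner ℂ (weakDeriv 1 (v Y)) (weakDeriv 1 (v Z))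
    + inner ℂ (weakDeriv 2 (w Y)) (weakDeriv 2 (w Z))
  conj_inner_symm Y Z := by
    simp only [map_add, inner_conj_symm]
  re_inner_nonneg Y := by
    simp only [map_add]
    exact add_nonneg (add_nonneg inner_self_nonneg inner_self_nonneg) inner_self_nonneg
  add_left X Y Z := by
    rw [map_add, map_add, map_add, weakDeriv_add ((u_mem X).1 2 le_rfl) ((u_mem Y).1 2 le_rfl),
      weakDeriv_add (v_mem X 1 le_rfl) (v_mem Y 1 le_rfl),
      weakDeriv_add ((w_mem X).1 2 le_rfl) ((w_mem Y).1 2 le_rfl),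
      inner_add_left, inner_add_left, inner_add_left]
    ring
  smul_left X Y c := by
    rw [map_smul, map_smul, map_smul, weakDeriv_smul c ((u_mem X).1 2 le_rfl),
      weakDeriv_smul c (v_mem X 1 le_rfl), weakDeriv_smul c ((w_mem X).1 2 le_rfl),
      inner_smul_left, inner_smul_left, inner_smul_left]
    ring
  definite Y h := by
    have h' := congrArg RCLike.re h
    simp only [map_add, map_zero] at h'
    have n1 := inner_self_nonneg (𝕜 := ℂ) (x := weakDeriv 2 (u Y))
    have n2 := inner_self_nonneg (𝕜 := ℂ) (x := weakDeriv 1 (v Y))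
    have n3 := inner_self_nonneg (𝕜 := ℂ) (x := weakDeriv 2 (w Y))
    refine eq_zero ?_ ?_ ?_
    · exact (re_inner_self_nonpos (𝕜 := ℂ)).1 (by linarith)
    · exact (re_inner_self_nonpos (𝕜 := ℂ)).1 (by linarith)
    · exact (re_inner_self_nonpos (𝕜 := ℂ)).1 (by linarith)

instance : NormedAddCommGroup (Disp G) := (core G).toNormedAddCommGroup

instance : InnerProductSpace ℂ (Disp G) := InnerProductSpace.ofCore (core G).toCore

end Disp

/-- The velocity space `𝕃`, the Hilbert sum of the three Lebesgue spaces. -/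
abbrev Vel (G : Geometry) : Type :=
  WithLp 2 (L2 G.l₀ G.l₁ × WithLp 2 (L2 G.l₁ G.l₂ × L2 G.l₂ G.l₃))

/-- The energy space `ℋ`, the Hilbert sum of `ℍ` and `𝕃`. -/
abbrev EnergySpace (G : Geometry) : Type := WithLp 2 (Disp G × Vel G)

/-- The element of `𝕃` with the given components. -/
def Vel.mk {G : Geometry} (f : L2 G.l₀ G.l₁) (g : L2 G.l₁ G.l₂) (h : L2 G.l₂ G.l₃) : Vel G :=
  WithLp.toLp 2 (f, WithLp.toLp 2 (g, h))

/-- The element of `ℋ` with the given displacement and velocity. -/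
def EnergySpace.mk {G : Geometry} (Y : Disp G) (z : Vel G) : EnergySpace G :=
  WithLp.toLp 2 (Y, z)

/-- The inclusion of `ℍ × ℍ` into `ℋ = ℍ × 𝕃`. -/
def incl (G : Geometry) : Disp G × Disp G →ₗ[ℂ] EnergySpace G where
  toFun P := EnergySpace.mk P.1 (Vel.mk (Disp.u P.2) (Disp.v P.2) (Disp.w P.2))
  map_add' P Q := by
    simp only [Prod.fst_add, Prod.snd_add, map_add]; rfl
  map_smul' c P := by
    simp only [Prod.smul_fst, Prod.smul_snd, map_smul]; rfl

lemma incl_injective (G : Geometry) : Function.Injective (incl G) := by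
  rintro ⟨Y, Z⟩ ⟨Y', Z'⟩ h
  have h1 : Y = Y' := congrArg (fun U : EnergySpace G => U.fst) h
  have h2 : Disp.u Z = Disp.u Z' := congrArg (fun U : EnergySpace G => U.snd.fst) h
  have h3 : Disp.v Z = Disp.v Z' := congrArg (fun U : EnergySpace G => U.snd.snd.fst) h
  have h4 : Disp.w Z = Disp.w Z' := congrArg (fun U : EnergySpace G => U.snd.snd.snd) h
  rw [h1, Disp.ext h2 h3 h4]

/-! ### The operator -/

/-- The matrix operator applied to `U = (u₁, v₁, w₁, u₂, v₂, w₂)` in `ℍ × ℍ`: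
`(u₂, v₂, w₂, -u₁⁗ + ρ₁ u₂'', v₁'' - β v₂, -w₁⁗ + ρ₂ w₂'')`. -/
def matrixOp {G : Geometry} (ρ₁ ρ₂ β : ℝ) (U : Disp G × Disp G) : EnergySpace G :=
  EnergySpace.mk U.2 (Vel.mk
    (-weakDeriv 4 (Disp.u U.1) + (ρ₁ : ℂ) • weakDeriv 2 (Disp.u U.2))
    (weakDeriv 2 (Disp.v U.1) - (β : ℂ) • Disp.v U.2)
    (-weakDeriv 4 (Disp.w U.1) + (ρ₂ : ℂ) • weakDeriv 2 (Disp.w U.2)))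

/-- The form `a(U, V)`, linear in `U` and conjugate linear in `V`; the pairing of `f` with `g` that
is linear in `f` and conjugate linear in `g` reads `inner ℂ g f`. -/
def aForm {G : Geometry} (ρ₁ ρ₂ β : ℝ) (U V : Disp G × Disp G) : ℂ :=
  inner ℂ (weakDeriv 2 (Disp.u V.1)) (weakDeriv 2 (Disp.u U.2))
  + inner ℂ (weakDeriv 1 (Disp.v V.1)) (weakDeriv 1 (Disp.v U.2))
  + inner ℂ (weakDeriv 2 (Disp.w V.1)) (weakDeriv 2 (Disp.w U.2))
  - inner ℂ (weakDeriv 2 (Disp.u V.2)) (weakDeriv 2 (Disp.u U.1))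
  - ρ₁ * inner ℂ (weakDeriv 1 (Disp.u V.2)) (weakDeriv 1 (Disp.u U.2))
  - β * inner ℂ (Disp.v V.2) (Disp.v U.2)
  - inner ℂ (weakDeriv 1 (Disp.v V.2)) (weakDeriv 1 (Disp.v U.1))
  - inner ℂ (weakDeriv 2 (Disp.w V.2)) (weakDeriv 2 (Disp.w U.1))
  - ρ₂ * inner ℂ (weakDeriv 1 (Disp.w V.2)) (weakDeriv 1 (Disp.w U.2))

/-- The fourth derivatives of the beam displacements and the second derivative of the string
displacement are square integrable. -/
def Regular {G : Geometry} (U : Disp G × Disp G) : Prop :=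
  (∃ p, IsWeakDeriv 4 (Disp.u U.1) p) ∧ (∃ p, IsWeakDeriv 2 (Disp.v U.1) p) ∧
    (∃ p, IsWeakDeriv 4 (Disp.w U.1) p)

/-- The transmission conditions in the weak sense: `⟨AU, V⟩ = a(U, V)` for all `V` in `ℍ × ℍ`. -/
def WeakTransmission {G : Geometry} (ρ₁ ρ₂ β : ℝ) (U : Disp G × Disp G) : Prop :=
  ∀ V : Disp G × Disp G, inner ℂ (incl G V) (matrixOp ρ₁ ρ₂ β U) = aForm ρ₁ ρ₂ β U V

lemma matrixOp_add {G : Geometry} (ρ₁ ρ₂ β : ℝ) {U V : Disp G × Disp G} (hU : Regular U)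
    (hV : Regular V) :
    matrixOp ρ₁ ρ₂ β (U + V) = matrixOp ρ₁ ρ₂ β U + matrixOp ρ₁ ρ₂ β V := by
  have e : ∀ (Y Y' : Disp G) (f f' : L2 G.l₀ G.l₁) (g g' : L2 G.l₁ G.l₂) (h h' : L2 G.l₂ G.l₃),
      EnergySpace.mk (Y + Y') (Vel.mk (f + f') (g + g') (h + h'))
        = EnergySpace.mk Y (Vel.mk f g h) + EnergySpace.mk Y' (Vel.mk f' g' h') :=
    fun _ _ _ _ _ _ _ _ => rfl
  rw [matrixOp, matrixOp, matrixOp, ← e]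
  simp only [Prod.fst_add, Prod.snd_add, map_add]
  rw [weakDeriv_add hU.1 hV.1, weakDeriv_add hU.2.1 hV.2.1, weakDeriv_add hU.2.2 hV.2.2,
    weakDeriv_add ((Disp.u_mem U.2).1 2 le_rfl) ((Disp.u_mem V.2).1 2 le_rfl),
    weakDeriv_add ((Disp.w_mem U.2).1 2 le_rfl) ((Disp.w_mem V.2).1 2 le_rfl)]
  congr 2
  · module
  · module
  · module

lemma matrixOp_smul {G : Geometry} (ρ₁ ρ₂ β : ℝ) (c : ℂ) {U : Disp G × Disp G}
    (hU : Regular U) : matrixOp ρ₁ ρ₂ β (c • U) = c • matrixOp ρ₁ ρ₂ β U := by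
  have e : ∀ (Y : Disp G) (f : L2 G.l₀ G.l₁) (g : L2 G.l₁ G.l₂) (h : L2 G.l₂ G.l₃),
      EnergySpace.mk (c • Y) (Vel.mk (c • f) (c • g) (c • h))
        = c • EnergySpace.mk Y (Vel.mk f g h) :=
    fun _ _ _ _ => rfl
  rw [matrixOp, matrixOp, ← e]
  simp only [Prod.smul_fst, Prod.smul_snd, map_smul]
  rw [weakDeriv_smul c hU.1, weakDeriv_smul c hU.2.1, weakDeriv_smul c hU.2.2,
    weakDeriv_smul c ((Disp.u_mem U.2).1 2 le_rfl),
    weakDeriv_smul c ((Disp.w_mem U.2).1 2 le_rfl)]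
  congr 2
  · module
  · module
  · module

lemma aForm_add {G : Geometry} (ρ₁ ρ₂ β : ℝ) (U U' V : Disp G × Disp G) :
    aForm ρ₁ ρ₂ β (U + U') V = aForm ρ₁ ρ₂ β U V + aForm ρ₁ ρ₂ β U' V := by
  have a1 : ∀ Y Z : Disp G, weakDeriv 1 (Disp.u (Y + Z))
      = weakDeriv 1 (Disp.u Y) + weakDeriv 1 (Disp.u Z) := fun Y Z => by
    rw [map_add, weakDeriv_add ((Disp.u_mem Y).1 1 (by norm_num)) ((Disp.u_mem Z).1 1 (by norm_num))]
  have a2 : ∀ Y Z : Disp G, weakDeriv 2 (Disp.u (Y + Z))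
      = weakDeriv 2 (Disp.u Y) + weakDeriv 2 (Disp.u Z) := fun Y Z => by
    rw [map_add, weakDeriv_add ((Disp.u_mem Y).1 2 le_rfl) ((Disp.u_mem Z).1 2 le_rfl)]
  have a3 : ∀ Y Z : Disp G, weakDeriv 1 (Disp.v (Y + Z))
      = weakDeriv 1 (Disp.v Y) + weakDeriv 1 (Disp.v Z) := fun Y Z => by
    rw [map_add, weakDeriv_add (Disp.v_mem Y 1 le_rfl) (Disp.v_mem Z 1 le_rfl)]
  have a4 : ∀ Y Z : Disp G, weakDeriv 1 (Disp.w (Y + Z))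
      = weakDeriv 1 (Disp.w Y) + weakDeriv 1 (Disp.w Z) := fun Y Z => by
    rw [map_add, weakDeriv_add ((Disp.w_mem Y).1 1 (by norm_num)) ((Disp.w_mem Z).1 1 (by norm_num))]
  have a5 : ∀ Y Z : Disp G, weakDeriv 2 (Disp.w (Y + Z))
      = weakDeriv 2 (Disp.w Y) + weakDeriv 2 (Disp.w Z) := fun Y Z => by
    rw [map_add, weakDeriv_add ((Disp.w_mem Y).1 2 le_rfl) ((Disp.w_mem Z).1 2 le_rfl)]
  simp only [aForm, Prod.fst_add, Prod.snd_add, a1, a2, a3, a4, a5, inner_add_right]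
  rw [map_add Disp.v, inner_add_right]
  ring

lemma aForm_smul {G : Geometry} (ρ₁ ρ₂ β : ℝ) (c : ℂ) (U V : Disp G × Disp G) :
    aForm ρ₁ ρ₂ β (c • U) V = c * aForm ρ₁ ρ₂ β U V := by
  have a1 : ∀ Y : Disp G, weakDeriv 1 (Disp.u (c • Y)) = c • weakDeriv 1 (Disp.u Y) := fun Y => by
    rw [map_smul, weakDeriv_smul c ((Disp.u_mem Y).1 1 (by norm_num))]
  have a2 : ∀ Y : Disp G, weakDeriv 2 (Disp.u (c • Y)) = c • weakDeriv 2 (Disp.u Y) := fun Y => by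
    rw [map_smul, weakDeriv_smul c ((Disp.u_mem Y).1 2 le_rfl)]
  have a3 : ∀ Y : Disp G, weakDeriv 1 (Disp.v (c • Y)) = c • weakDeriv 1 (Disp.v Y) := fun Y => by
    rw [map_smul, weakDeriv_smul c (Disp.v_mem Y 1 le_rfl)]
  have a4 : ∀ Y : Disp G, weakDeriv 1 (Disp.w (c • Y)) = c • weakDeriv 1 (Disp.w Y) := fun Y => by
    rw [map_smul, weakDeriv_smul c ((Disp.w_mem Y).1 1 (by norm_num))]
  have a5 : ∀ Y : Disp G, weakDeriv 2 (Disp.w (c • Y)) = c • weakDeriv 2 (Disp.w Y) := fun Y => by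
    rw [map_smul, weakDeriv_smul c ((Disp.w_mem Y).1 2 le_rfl)]
  simp only [aForm, Prod.smul_fst, Prod.smul_snd, a1, a2, a3, a4, a5, inner_smul_right]
  rw [map_smul Disp.v, inner_smul_right]
  ring

/-- The domain of the operator, as a subspace of `ℍ × ℍ`. -/
def domPairs (G : Geometry) (ρ₁ ρ₂ β : ℝ) : Submodule ℂ (Disp G × Disp G) where
  carrier := {U | Regular U ∧ WeakTransmission ρ₁ ρ₂ β U}
  zero_mem' := by
    have hR : Regular (0 : Disp G × Disp G) := by
      refine ⟨⟨0, ?_⟩, ⟨0, ?_⟩, ⟨0, ?_⟩⟩ <;>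
        simpa only [Prod.fst_zero, map_zero] using isWeakDeriv_zero_zero _
    refine ⟨hR, fun V => ?_⟩
    have h1 := matrixOp_smul ρ₁ ρ₂ β 0 hR
    have h2 := aForm_smul ρ₁ ρ₂ β 0 (0 : Disp G × Disp G) V
    rw [zero_smul, zero_smul] at h1
    rw [zero_smul, zero_mul] at h2
    rw [h1, h2, inner_zero_right]
  add_mem' := by
    rintro U V ⟨hU, tU⟩ ⟨hV, tV⟩
    refine ⟨⟨?_, ?_, ?_⟩, fun W => ?_⟩
    · obtain ⟨p, hp⟩ := hU.1
      obtain ⟨q, hq⟩ := hV.1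
      exact ⟨p + q, by simpa only [Prod.fst_add, map_add] using hp.add hq⟩
    · obtain ⟨p, hp⟩ := hU.2.1
      obtain ⟨q, hq⟩ := hV.2.1
      exact ⟨p + q, by simpa only [Prod.fst_add, map_add] using hp.add hq⟩
    · obtain ⟨p, hp⟩ := hU.2.2
      obtain ⟨q, hq⟩ := hV.2.2
      exact ⟨p + q, by simpa only [Prod.fst_add, map_add] using hp.add hq⟩
    · rw [matrixOp_add ρ₁ ρ₂ β hU hV, inner_add_right, tU W, tV W, aForm_add]
  smul_mem' := by
    rintro c U ⟨hU, tU⟩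
    refine ⟨⟨?_, ?_, ?_⟩, fun W => ?_⟩
    · obtain ⟨p, hp⟩ := hU.1
      exact ⟨c • p, by simpa only [Prod.smul_fst, map_smul] using hp.smul c⟩
    · obtain ⟨p, hp⟩ := hU.2.1
      exact ⟨c • p, by simpa only [Prod.smul_fst, map_smul] using hp.smul c⟩
    · obtain ⟨p, hp⟩ := hU.2.2
      exact ⟨c • p, by simpa only [Prod.smul_fst, map_smul] using hp.smul c⟩
    · rw [matrixOp_smul ρ₁ ρ₂ β c hU, inner_smul_right, tU W, aForm_smul]

/-- The unbounded operator `𝒜` on `ℋ`: its domain is the set of all `U` in `ℍ × ℍ`, seen inside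
`ℋ`, which are regular and satisfy the transmission conditions in the weak sense, and there it acts
as the matrix operator. -/
def systemOp (G : Geometry) (ρ₁ ρ₂ β : ℝ) : EnergySpace G →ₗ.[ℂ] EnergySpace G where
  domain := (domPairs G ρ₁ ρ₂ β).map (incl G)
  toFun :=
    { toFun := fun U : domPairs G ρ₁ ρ₂ β => matrixOp ρ₁ ρ₂ β U.1
      map_add' := fun U V => matrixOp_add ρ₁ ρ₂ β U.2.1 V.2.1
      map_smul' := fun c U => matrixOp_smul ρ₁ ρ₂ β c U.2.1 } ∘ₗ
    ((domPairs G ρ₁ ρ₂ β).equivMapOfInjective (incl G) (incl_injective G)).symm.toLinearMap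

/-- The operator acts on its domain as the matrix operator. -/
lemma systemOp_apply (G : Geometry) (ρ₁ ρ₂ β : ℝ) (U : Disp G × Disp G)
    (hU : U ∈ domPairs G ρ₁ ρ₂ β) :
    systemOp G ρ₁ ρ₂ β ⟨incl G U, Submodule.mem_map_of_mem hU⟩ = matrixOp ρ₁ ρ₂ β U := by
  have h : ((domPairs G ρ₁ ρ₂ β).equivMapOfInjective (incl G) (incl_injective G)).symm
      ⟨incl G U, Submodule.mem_map_of_mem hU⟩ = ⟨U, hU⟩ := by
    rw [LinearEquiv.symm_apply_eq]
    rfl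
  exact congrArg (fun P : domPairs G ρ₁ ρ₂ β => matrixOp ρ₁ ρ₂ β P.1) h

/-! ### Strongly continuous semigroups and classical solutions -/

section Semigroup

variable {X : Type*} [NormedAddCommGroup X] [NormedSpace ℂ X]

/-- A strongly continuous one-parameter semigroup of bounded linear operators. -/
structure IsC0Semigroup (S : ℝ≥0 → X →L[ℂ] X) : Prop where
  map_zero : S 0 = ContinuousLinearMap.id ℂ X
  map_add : ∀ s t, S (s + t) = (S s).comp (S t)
  tendsto_zero : ∀ x, Tendsto (fun t => S t x) (𝓝[>] 0) (𝓝 x)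

/-- `A` is the infinitesimal generator of `S`: a vector `x` is in the domain of `A` with `A x = y`
if and only if the difference quotients `(S h x - x) / h` converge to `y` as `h` tends to zero from
the right. -/
def IsGenerator (A : X →ₗ.[ℂ] X) (S : ℝ≥0 → X →L[ℂ] X) : Prop :=
  ∀ x y : X, (x, y) ∈ A.graph ↔
    Tendsto (fun h : ℝ≥0 => (h : ℝ)⁻¹ • (S h x - x)) (𝓝[>] 0) (𝓝 y)

/-- `U` is a classical solution of `dU/dt = A U` for `t > 0`, `U 0 = U₀`: it is continuous on the
closed half line, continuously differentiable on the open half line, takes its values in the domain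
of `A` there and satisfies the equation. Values at negative times are irrelevant. -/
structure IsClassicalSolution (A : X →ₗ.[ℂ] X) (U₀ : X) (U : ℝ → X) : Prop where
  initial : U 0 = U₀
  continuousOn : ContinuousOn U (Ici 0)
  contDiffOn : ContDiffOn ℝ 1 U (Ioi 0)
  equation : ∀ t : ℝ, 0 < t → ∃ h : U t ∈ A.domain, HasDerivAt U (A ⟨U t, h⟩) t

/-- `U` is continuously differentiable on the closed half line (one-sidedly at zero). -/
def IsC1 (U : ℝ → X) : Prop := ContDiffOn ℝ 1 U (Ici 0)

end Semigroup

end BeamString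

end

/-! The operator is m-dissipative on a Hilbert space, so it generates a contraction semigroup by the
Lumer–Phillips theorem, which is proved here by Yosida approximation.

Abstract half. For an m-dissipative `A` the operators `c (c - A)⁻¹` are commuting contractions, and
in a Hilbert space the domain is automatically dense (`dense_domain`). Hence the Yosida
approximations `Aₙ` are bounded, dissipative and commuting, and `Aₙ x → A x` on the domain
(`tendsto_yosida`). Their exponentials are contractions with `‖exp(t Aₘ) x - exp(t Aₙ) x‖ ≤ t ‖Aₘ x
- Aₙ x‖` (`norm_exp_sub_exp_le`), so they converge strongly to a contraction semigroup. Its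
generator extends `A`, and it cannot be larger, because it is dissipative while `1 - A` is already
onto (`isGenerator`). Orbits from the domain are integrals of `S(s) A x`, hence continuously
differentiable. Dissipativity makes the distance of two solutions decrease, which gives uniqueness
and continuous dependence.

Concrete half. Clamping and continuity at `l₁` fix every constant of integration, and continuity at
`l₂` is one more scalar equation. So `(u, v, w) ↦ (u'', v', w'')` maps `ℍ` isometrically onto the
kernel of a bounded functional, and `ℍ` is complete (`range_strain`). The weak transmission
condition tested with `U` itself gives `Re ⟨AU, U⟩ = -ρ₁ ‖u₂'‖² - β ‖v₂‖² - ρ₂ ‖w₂'‖² ≤ 0`. In the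
resolvent equation the velocity is `c` times the displacement minus a datum; eliminating it leaves a
coercive problem on `ℍ`, solved as in the Lax–Milgram theorem. Testing with compactly supported
functions yields the regularity of the solution, and the full variational equation is then the weak
transmission condition, so no boundary term has to be computed. -/

noncomputable section

namespace BeamString

/-! ### Contraction semigroups generated by m-dissipative operators -/

section Generation

variable {X : Type*} [NormedAddCommGroup X] [InnerProductSpace ℂ X]

/-- A differentiable curve in a Hilbert space whose velocity points inwards has decreasing norm. -/
lemma norm_le_of_re_inner_deriv_nonpos {f f' : ℝ → X} (hc : ContinuousOn f (Ici 0))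
    (hd : ∀ t, 0 < t → HasDerivAt f (f' t) t) (hn : ∀ t, 0 < t → (inner ℂ (f t) (f' t)).re ≤ 0)
    {t : ℝ} (ht : 0 ≤ t) : ‖f t‖ ≤ ‖f 0‖ := by
  -- Time is real, so `‖f‖²` is differentiated with the real inner product `Re ⟨·, ·⟩`; its
  -- derivative is `2 Re ⟨f, f'⟩`.
  let _ : InnerProductSpace ℝ X := InnerProductSpace.rclikeToReal ℂ X
  have hd2 : ∀ s, 0 < s → HasDerivAt (fun x => ‖f x‖ ^ 2) (2 * inner ℝ (f s) (f' s)) s :=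
    fun s hs => (hd s hs).norm_sq
  have hanti : AntitoneOn (fun x => ‖f x‖ ^ 2) (Ici (0 : ℝ)) := by
    refine antitoneOn_of_deriv_nonpos (convex_Ici 0) (hc.norm.pow 2) ?_ ?_
    · rw [interior_Ici]
      exact fun s hs => (hd2 s hs).differentiableAt.differentiableWithinAt
    · rw [interior_Ici]
      intro s hs
      rw [(hd2 s hs).deriv]
      have h1 : inner ℝ (f s) (f' s) = (inner ℂ (f s) (f' s)).re := rfl
      have := hn s hs
      rw [h1]; linarith
  exact le_of_sq_le_sq (hanti self_mem_Ici ht ht) (norm_nonneg _)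

/-- An operator on a Hilbert space is m-dissipative if it is dissipative and `c - A` is surjective
for all `c > 0`.  Both conditions are stated for the graph. -/
structure IsMDissipative (A : X →ₗ.[ℂ] X) : Prop where
  re_inner_nonpos : ∀ p ∈ A.graph, (inner ℂ p.1 p.2).re ≤ 0
  exists_mem_graph : ∀ c : ℝ, 0 < c → ∀ y : X, ∃ x : X, (x, (c : ℂ) • x - y) ∈ A.graph

/-! ### Resolvents and Yosida approximations. -/

namespace IsMDissipative

variable {A : X →ₗ.[ℂ] X}

/-- Pairing `c x - A x = y` with `x` and dropping the dissipative term leaves `c ‖x‖² ≤ Re ⟨x, y⟩ ≤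
‖x‖ ‖y‖`. -/
lemma norm_le (hA : IsMDissipative A) {c : ℝ} (hc : 0 < c) {x y : X}
    (h : (x, (c : ℂ) • x - y) ∈ A.graph) : ‖x‖ ≤ c⁻¹ * ‖y‖ := by
  have h1 := hA.re_inner_nonpos _ h
  simp only [inner_sub_right, inner_smul_right, inner_self_eq_norm_sq_to_K, Complex.sub_re] at h1
  have h2 : ((c : ℂ) * ((‖x‖ : ℂ)) ^ 2).re = c * ‖x‖ ^ 2 := by norm_cast
  have h3 : (inner ℂ x y).re ≤ ‖x‖ * ‖y‖ := re_inner_le_norm (𝕜 := ℂ) x y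
  have h4 : c * ‖x‖ ^ 2 ≤ ‖x‖ * ‖y‖ := by
    have : ((c : ℂ) * ((‖x‖ : ℂ)) ^ 2).re - (inner ℂ x y).re ≤ 0 := h1
    rw [h2] at this
    linarith
  rcases (norm_nonneg x).eq_or_lt with h0 | h0
  · rw [← h0]; positivity
  · rw [inv_mul_eq_div, le_div_iff₀ hc]
    nlinarith

lemma mem_graph_unique (hA : IsMDissipative A) {c : ℝ} (hc : 0 < c) {x x' y : X}
    (h : (x, (c : ℂ) • x - y) ∈ A.graph) (h' : (x', (c : ℂ) • x' - y) ∈ A.graph) : x = x' := by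
  have h1 := A.graph.sub_mem h h'
  have h2 : (x - x', (c : ℂ) • (x - x') - 0) ∈ A.graph := by
    convert h1 using 1
    simp only [Prod.mk_sub_mk, smul_sub]
    congr 1
    abel
  have h3 := hA.norm_le hc h2
  rw [norm_zero, mul_zero] at h3
  exact sub_eq_zero.1 (norm_le_zero_iff.1 h3)

/-- The resolvent `(c - A)⁻¹`, for positive `c`. -/
def resolvent (hA : IsMDissipative A) (c : ℝ) (hc : 0 < c) : X →L[ℂ] X :=
  LinearMap.mkContinuous
    { toFun := fun y => (hA.exists_mem_graph c hc y).choose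
      map_add' := fun y z => by
        refine hA.mem_graph_unique hc (hA.exists_mem_graph c hc (y + z)).choose_spec ?_
        convert A.graph.add_mem (hA.exists_mem_graph c hc y).choose_spec
          (hA.exists_mem_graph c hc z).choose_spec using 1
        simp only [Prod.mk_add_mk, smul_add]
        congr 1
        abel
      map_smul' := fun k y => by
        refine hA.mem_graph_unique hc (hA.exists_mem_graph c hc (k • y)).choose_spec ?_
        convert A.graph.smul_mem k (hA.exists_mem_graph c hc y).choose_spec using 1
        simp only [Prod.smul_mk, smul_sub, RingHom.id_apply]
        rw [smul_comm] }
    c⁻¹ fun y => hA.norm_le hc (hA.exists_mem_graph c hc y).choose_spec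

lemma resolvent_mem (hA : IsMDissipative A) {c : ℝ} (hc : 0 < c) (y : X) :
    (hA.resolvent c hc y, (c : ℂ) • hA.resolvent c hc y - y) ∈ A.graph :=
  (hA.exists_mem_graph c hc y).choose_spec

lemma norm_resolvent_le (hA : IsMDissipative A) {c : ℝ} (hc : 0 < c) (y : X) :
    ‖hA.resolvent c hc y‖ ≤ c⁻¹ * ‖y‖ :=
  hA.norm_le hc (hA.resolvent_mem hc y)

lemma resolvent_sub (hA : IsMDissipative A) {c : ℝ} (hc : 0 < c) {x z : X}
    (h : (x, z) ∈ A.graph) : hA.resolvent c hc ((c : ℂ) • x - z) = x :=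
  hA.mem_graph_unique hc (hA.resolvent_mem hc _) (by simpa using h)

/-- With `x = (d - A)⁻¹ y` one has `c x - A x = y + (c - d) x`; apply `(c - A)⁻¹`. -/
lemma resolvent_identity (hA : IsMDissipative A) {c d : ℝ} (hc : 0 < c) (hd : 0 < d) (y : X) :
    hA.resolvent c hc y + ((c : ℂ) - d) • hA.resolvent c hc (hA.resolvent d hd y)
      = hA.resolvent d hd y := by
  conv_rhs => rw [← hA.resolvent_sub hc (hA.resolvent_mem hd y)]
  rw [← map_smul, ← map_add]
  congr 1
  module

/-- For `c ≠ d` the resolvent identity, read in both orders, expresses `(c - d)` times either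
product as the same difference of resolvents. -/
lemma resolvent_commute (hA : IsMDissipative A) {c d : ℝ} (hc : 0 < c) (hd : 0 < d) :
    Commute (hA.resolvent c hc) (hA.resolvent d hd) := by
  rcases eq_or_ne c d with rfl | hcd
  · exact Commute.refl _
  ext y
  have h1 := hA.resolvent_identity hc hd y
  have h2 := hA.resolvent_identity hd hc y
  have hne : ((c : ℂ) - d) ≠ 0 := sub_ne_zero.2 (by exact_mod_cast hcd)
  refine smul_right_injective X hne ?_
  simp only [mul_apply_eq_comp]
  rw [← neg_sub (c : ℂ) d, neg_smul, ← sub_eq_add_neg, sub_eq_iff_eq_add,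
    ← sub_eq_iff_eq_add'] at h2
  rw [eq_comm, ← sub_eq_iff_eq_add'] at h1
  rw [← h1, ← h2]

/-- The Yosida approximation `c (c (c - A)⁻¹ - 1)` with `c = n + 1`. -/
def yosida (hA : IsMDissipative A) (n : ℕ) : X →L[ℂ] X :=
  ((n + 1 : ℝ) : ℂ) • (((n + 1 : ℝ) : ℂ) • hA.resolvent (n + 1) n.cast_add_one_pos - 1)

/-- `c (c - A)⁻¹` is a contraction `T`, and `Re ⟨x, T x - x⟩ ≤ 0` for any contraction by
Cauchy–Schwarz. -/
lemma yosida_re_inner_nonpos (hA : IsMDissipative A) (n : ℕ) (x : X) :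
    (inner ℂ x (hA.yosida n x)).re ≤ 0 := by
  have hc : (0 : ℝ) < n + 1 := n.cast_add_one_pos
  have e : hA.yosida n x
      = ((n + 1 : ℝ) : ℂ) • (((n + 1 : ℝ) : ℂ) • hA.resolvent (n + 1) hc x - x) := rfl
  rw [e, inner_smul_right, Complex.re_ofReal_mul]
  refine mul_nonpos_of_nonneg_of_nonpos hc.le ?_
  rw [inner_sub_right, Complex.sub_re]
  have h1 : (inner ℂ x x).re = ‖x‖ ^ 2 := inner_self_eq_norm_sq (𝕜 := ℂ) x
  have h2 : (inner ℂ x (((n + 1 : ℝ) : ℂ) • hA.resolvent (n + 1) hc x)).re ≤ ‖x‖ * ‖x‖ := by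
    refine (re_inner_le_norm (𝕜 := ℂ) _ _).trans ?_
    gcongr
    rw [norm_smul, Complex.norm_real, Real.norm_of_nonneg hc.le]
    have := hA.norm_resolvent_le hc x
    rwa [inv_mul_eq_div, le_div_iff₀ hc, mul_comm] at this
  rw [h1]
  linarith

lemma yosida_commute (hA : IsMDissipative A) (m n : ℕ) :
    Commute (hA.yosida m) (hA.yosida n) := by
  have h := hA.resolvent_commute (c := m + 1) (d := n + 1) m.cast_add_one_pos n.cast_add_one_pos
  exact ((((h.smul_left _).smul_right _).sub_left (Commute.one_left _)).sub_right
    (Commute.one_right _)).smul_left _ |>.smul_right _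

/-- On the domain `c (c - A)⁻¹ x - x = (c - A)⁻¹ A x`. This form gives both the bound by `‖A x‖`,
uniform in `n`, and the convergence to `A x`. -/
lemma yosida_apply (hA : IsMDissipative A) (n : ℕ) {x z : X} (h : (x, z) ∈ A.graph) :
    hA.yosida n x
      = ((n + 1 : ℝ) : ℂ) • hA.resolvent (n + 1) n.cast_add_one_pos z := by
  have hc : (0 : ℝ) < n + 1 := n.cast_add_one_pos
  have h1 := hA.resolvent_sub hc h
  rw [map_sub, map_smul, sub_eq_iff_eq_add, ← sub_eq_iff_eq_add'] at h1
  rw [← h1]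
  rfl

lemma norm_smul_resolvent_le (hA : IsMDissipative A) {c : ℝ} (hc : 0 < c) (z : X) :
    ‖(c : ℂ) • hA.resolvent c hc z‖ ≤ ‖z‖ := by
  rw [norm_smul, Complex.norm_real, Real.norm_of_nonneg hc.le]
  have := hA.norm_resolvent_le hc z
  rwa [inv_mul_eq_div, le_div_iff₀ hc, mul_comm] at this

lemma norm_yosida_le (hA : IsMDissipative A) (n : ℕ) {x z : X} (h : (x, z) ∈ A.graph) :
    ‖hA.yosida n x‖ ≤ ‖z‖ := by
  rw [hA.yosida_apply n h]
  exact hA.norm_smul_resolvent_le _ z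

/-- The distance of two classical solutions does not increase. -/
lemma norm_sub_le (hA : IsMDissipative A) {U₀ V₀ : X} {U V : ℝ → X}
    (hU : IsClassicalSolution A U₀ U) (hV : IsClassicalSolution A V₀ V) {t : ℝ} (ht : 0 ≤ t) :
    ‖U t - V t‖ ≤ ‖U₀ - V₀‖ := by
  rw [← hU.initial, ← hV.initial]
  -- The velocity is chosen for every real `s`, with the junk value `0` for `s ≤ 0`, where nothing
  -- is claimed.
  have h : ∀ s : ℝ, ∃ z, 0 < s → HasDerivAt (fun t => U t - V t) z s ∧
      (inner ℂ (U s - V s) z).re ≤ 0 := by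
    intro s
    by_cases hs : 0 < s
    · obtain ⟨hu, du⟩ := hU.equation s hs
      obtain ⟨hv, dv⟩ := hV.equation s hs
      exact ⟨_, fun _ => ⟨du.sub dv, hA.re_inner_nonpos _
        (A.graph.sub_mem (A.mem_graph ⟨U s, hu⟩) (A.mem_graph ⟨V s, hv⟩))⟩⟩
    · exact ⟨0, fun h => absurd h hs⟩
  choose z hz using h
  exact norm_le_of_re_inner_deriv_nonpos (f := fun t => U t - V t) (f' := z)
    (hU.continuousOn.sub hV.continuousOn) (fun s hs => (hz s hs).1) (fun s hs => (hz s hs).2) ht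

/-- The domain of an m-dissipative operator on a Hilbert space is dense. -/
lemma dense_domain [CompleteSpace X] (hA : IsMDissipative A) : Dense (A.domain : Set X) := by
  rw [Submodule.dense_iff_topologicalClosure_eq_top,
    Submodule.topologicalClosure_eq_top_iff, Submodule.eq_bot_iff]
  intro z hz
  -- For `z` orthogonal to the domain, `x = (1 - A)⁻¹ z` lies in the domain, so dissipativity gives
  -- `‖x‖² ≤ Re ⟨x, z⟩ = 0`. Then `z = x - A x = 0`.
  set x := hA.resolvent 1 one_pos z with hx
  have h1 := hA.resolvent_mem one_pos z
  rw [← hx] at h1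
  have hmem : x ∈ A.domain := by
    obtain ⟨y, hy, -⟩ := (LinearPMap.mem_graph_iff A).1 h1
    exact (show (y : X) = x from hy) ▸ y.2
  have h2 := hA.re_inner_nonpos _ h1
  have h3 : inner ℂ x z = 0 := hz x hmem
  simp only [inner_sub_right, inner_smul_right, h3, Complex.ofReal_one, one_mul, sub_zero] at h2
  have h4 : (inner ℂ x x).re = ‖x‖ ^ 2 := inner_self_eq_norm_sq (𝕜 := ℂ) x
  have hx0 : x = 0 := by
    rw [← norm_le_zero_iff]
    nlinarith [norm_nonneg x]
  rw [hx0] at h1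
  have h5 := (LinearPMap.graph_fst_eq_zero_snd A h1 rfl)
  simpa using h5

end IsMDissipative

/-! #### Exponentials of bounded dissipative operators -/

lemma _root_.HasDerivAt.apply_const {T : ℝ → X →L[ℂ] X} {T' : X →L[ℂ] X} {t : ℝ}
    (h : HasDerivAt T T' t) (x : X) : HasDerivAt (fun s => T s x) (T' x) t :=
  ((ContinuousLinearMap.apply ℂ X x).restrictScalars ℝ).hasFDerivAt.comp_hasDerivAt t h

variable [CompleteSpace X]

lemma hasDerivAt_exp_apply (B : X →L[ℂ] X) (x : X) (t : ℝ) :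
    HasDerivAt (fun s : ℝ => NormedSpace.exp (s • B) x) (B (NormedSpace.exp (t • B) x)) t :=
  (hasDerivAt_exp_smul_const' B t).apply_const x

lemma hasDerivAt_exp_apply' (B : X →L[ℂ] X) (x : X) (t : ℝ) :
    HasDerivAt (fun s : ℝ => NormedSpace.exp (s • B) x) (NormedSpace.exp (t • B) (B x)) t :=
  (hasDerivAt_exp_smul_const B t).apply_const x

/-- The orbit `f(s) = exp(s B) x` has velocity `B f(s)`, so its norm decreases. -/
lemma norm_exp_apply_le {B : X →L[ℂ] X} (hB : ∀ x, (inner ℂ x (B x)).re ≤ 0) {t : ℝ}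
    (ht : 0 ≤ t) (x : X) : ‖NormedSpace.exp (t • B) x‖ ≤ ‖x‖ := by
  have h := norm_le_of_re_inner_deriv_nonpos
    (f := fun s : ℝ => NormedSpace.exp (s • B) x)
    (fun s _ => (hasDerivAt_exp_apply B x s).continuousAt.continuousWithinAt)
    (fun s _ => hasDerivAt_exp_apply B x s) (fun s _ => hB _) ht
  simpa using h

/-- The path `s ↦ exp(s B) exp((t - s) C) x` joins the two orbits at time `t`. Because `B` and `C`
commute, its velocity is `exp(s B) exp((t - s) C) (B x - C x)`, which both contractions bound by `‖B
x - C x‖`. -/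
lemma norm_exp_sub_exp_le {B C : X →L[ℂ] X} (hB : ∀ x, (inner ℂ x (B x)).re ≤ 0)
    (hC : ∀ x, (inner ℂ x (C x)).re ≤ 0) (hBC : Commute B C) {t : ℝ} (ht : 0 ≤ t) (x : X) :
    ‖NormedSpace.exp (t • B) x - NormedSpace.exp (t • C) x‖ ≤ ‖B x - C x‖ * t := by
  have hder : ∀ s : ℝ, HasDerivAt
      (fun s : ℝ => NormedSpace.exp (s • B) (NormedSpace.exp ((t - s) • C) x))
      (NormedSpace.exp (s • B) (NormedSpace.exp ((t - s) • C) (B x - C x))) s := by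
    intro s
    have h1 := hasDerivAt_exp_smul_const B s
    have h2 := (hasDerivAt_exp_smul_const C (t - s)).scomp s
      ((hasDerivAt_id s).const_sub t)
    have h3 := (h1.mul h2).apply_const x
    have hcomm : B (NormedSpace.exp ((t - s) • C) x) = NormedSpace.exp ((t - s) • C) (B x) := by
      have : Commute B (NormedSpace.exp ((t - s) • C)) := (hBC.smul_right (t - s)).exp_right
      exact congrArg (fun T : X →L[ℂ] X => T x) this.eq
    refine h3.congr_deriv ?_
    simp only [Function.comp, neg_smul, one_smul, map_neg, map_sub, add_apply, neg_apply,
      mul_apply_eq_comp, hcomm]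
    abel
  have h := norm_image_sub_le_of_norm_deriv_le_segment'
    (f := fun s : ℝ => NormedSpace.exp (s • B) (NormedSpace.exp ((t - s) • C) x))
    (a := 0) (b := t) (C := ‖B x - C x‖) (fun s _ => (hder s).hasDerivWithinAt)
    (fun s hs => (norm_exp_apply_le hB hs.1 _).trans
      (norm_exp_apply_le hC (sub_nonneg.2 hs.2.le) _)) t (right_mem_Icc.2 ht)
  simpa using h

lemma norm_exp_sub_self_le {B : X →L[ℂ] X} (hB : ∀ x, (inner ℂ x (B x)).re ≤ 0) {t : ℝ}
    (ht : 0 ≤ t) (x : X) : ‖NormedSpace.exp (t • B) x - x‖ ≤ ‖B x‖ * t := by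
  simpa using norm_exp_sub_exp_le hB (C := 0) (by simp) (Commute.zero_right B) ht x

/-- The curve `exp(s B) x - s y` has velocity `exp(s B) B x - y`. In the application `y = A x` need
not lie in the domain, so `‖B y‖` has no bound uniform along the Yosida sequence; the detour through
a nearby `y'` in the domain costs `2 ‖y - y'‖` and leaves only `‖B y'‖`. -/
lemma norm_exp_sub_self_sub_smul_le {B : X →L[ℂ] X} (hB : ∀ x, (inner ℂ x (B x)).re ≤ 0) {t : ℝ}
    (ht : 0 ≤ t) (x y y' : X) :
    ‖NormedSpace.exp (t • B) x - x - t • y‖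
      ≤ (‖B x - y‖ + 2 * ‖y - y'‖ + ‖B y'‖ * t) * t := by
  have hder : ∀ s : ℝ, HasDerivAt (fun s : ℝ => NormedSpace.exp (s • B) x - s • y)
      (NormedSpace.exp (s • B) (B x) - y) s := fun s =>
    ((hasDerivAt_exp_apply' B x s).sub ((hasDerivAt_id s).smul_const y)).congr_deriv (by simp)
  have h := norm_image_sub_le_of_norm_deriv_le_segment'
    (f := fun s : ℝ => NormedSpace.exp (s • B) x - s • y)
    (a := 0) (b := t) (C := ‖B x - y‖ + 2 * ‖y - y'‖ + ‖B y'‖ * t)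
    (fun s _ => (hder s).hasDerivWithinAt) (fun s hs => by
      have e : NormedSpace.exp (s • B) (B x) - y = NormedSpace.exp (s • B) (B x - y)
          + NormedSpace.exp (s • B) (y - y') + (NormedSpace.exp (s • B) y' - y') + (y' - y) := by
        simp only [map_sub]; abel
      rw [e]
      have b1 := norm_exp_apply_le hB hs.1 (B x - y)
      have b2 := norm_exp_apply_le hB hs.1 (y - y')
      have b3 := norm_exp_sub_self_le hB hs.1 y'
      have b4 : ‖B y'‖ * s ≤ ‖B y'‖ * t := by gcongr; exact hs.2.le
      have b5 : ‖y' - y‖ = ‖y - y'‖ := norm_sub_rev _ _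
      refine (norm_add_le _ _).trans ?_
      refine (add_le_add_left (norm_add₃_le) _).trans ?_
      linarith) t (right_mem_Icc.2 ht)
  have e : NormedSpace.exp (t • B) x - t • y
      - (NormedSpace.exp ((0 : ℝ) • B) x - (0 : ℝ) • y)
      = NormedSpace.exp (t • B) x - x - t • y := by
    simp; abel
  rw [e, sub_zero] at h
  exact h

/-! #### The Yosida approximation and the generated semigroup -/

namespace IsMDissipative

variable {A : X →ₗ.[ℂ] X}

/-- Since `Aₙ x = c (c - A)⁻¹ z`, it suffices that `c (c - A)⁻¹ → 1` strongly. On the domain the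
error is `(c - A)⁻¹ A z₁ = O(1/c)`; density and contractivity extend this to all vectors. -/
lemma tendsto_yosida (hA : IsMDissipative A) {x z : X} (h : (x, z) ∈ A.graph) :
    Tendsto (fun n => hA.yosida n x) atTop (𝓝 z) := by
  rw [Metric.tendsto_atTop]
  intro ε hε
  obtain ⟨z₁, hz₁, hd⟩ := hA.dense_domain.exists_dist_lt z (ε := ε / 4) (by positivity)
  have hg := A.mem_graph ⟨z₁, hz₁⟩
  set z₂ := A ⟨z₁, hz₁⟩
  obtain ⟨N, hN⟩ := exists_nat_gt (‖z₂‖ / (ε / 4))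
  refine ⟨N, fun n hn => ?_⟩
  have hc : (0 : ℝ) < n + 1 := n.cast_add_one_pos
  rw [hA.yosida_apply n h, dist_eq_norm]
  have h1 : ((n + 1 : ℝ) : ℂ) • hA.resolvent (n + 1) hc z₁ - z₁ = hA.resolvent (n + 1) hc z₂ := by
    have := hA.resolvent_sub hc hg
    rwa [map_sub, map_smul, sub_eq_iff_eq_add, ← sub_eq_iff_eq_add'] at this
  have h2 : ‖hA.resolvent (n + 1) hc z₂‖ ≤ ε / 4 := by
    refine (hA.norm_resolvent_le hc z₂).trans ?_
    rw [inv_mul_eq_div, div_le_iff₀ hc]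
    rw [div_lt_iff₀ (by positivity)] at hN
    have : (N : ℝ) ≤ n := by exact_mod_cast hn
    nlinarith
  have h3 := hA.norm_smul_resolvent_le hc (z - z₁)
  rw [dist_eq_norm] at hd
  have e : ((n + 1 : ℝ) : ℂ) • hA.resolvent (n + 1) hc z - z
      = ((n + 1 : ℝ) : ℂ) • hA.resolvent (n + 1) hc (z - z₁) + hA.resolvent (n + 1) hc z₂
        + (z₁ - z) := by
    rw [← h1, map_sub, smul_sub]; abel
  rw [e]
  have h4 : ‖z₁ - z‖ = ‖z - z₁‖ := norm_sub_rev _ _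
  refine (norm_add₃_le).trans_lt ?_
  linarith

/-- The semigroups generated by the Yosida approximations converge. -/
lemma exists_tendsto_exp_yosida (hA : IsMDissipative A) {t : ℝ} (ht : 0 ≤ t) (x : X) :
    ∃ y, Tendsto (fun n => NormedSpace.exp (t • hA.yosida n) x) atTop (𝓝 y) := by
  refine cauchySeq_tendsto_of_complete (Metric.cauchySeq_iff.2 fun ε hε => ?_)
  -- Contractivity makes replacing `x` by `x₁` in the domain cost at most `ε / 4` in each orbit. On
  -- `x₁` the sequence `Aₙ x₁` converges, and this controls the difference of the exponentials.
  obtain ⟨x₁, hx₁, hd⟩ := hA.dense_domain.exists_dist_lt x (ε := ε / 4) (by positivity)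
  have hY := hA.tendsto_yosida (A.mem_graph ⟨x₁, hx₁⟩)
  -- The factor `t + 1` instead of `t` keeps the tolerance positive at `t = 0`.
  obtain ⟨N, hN⟩ := Metric.cauchySeq_iff.1 hY.cauchySeq (ε / (4 * (t + 1))) (by positivity)
  refine ⟨N, fun m hm n hn => ?_⟩
  have h1 := hN m hm n hn
  rw [dist_eq_norm, lt_div_iff₀ (by positivity)] at h1
  have h2 := norm_exp_sub_exp_le (hA.yosida_re_inner_nonpos m) (hA.yosida_re_inner_nonpos n)
    (hA.yosida_commute m n) ht x₁
  have h3 := norm_exp_apply_le (hA.yosida_re_inner_nonpos m) ht (x - x₁)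
  have h4 := norm_exp_apply_le (hA.yosida_re_inner_nonpos n) ht (x₁ - x)
  rw [norm_sub_rev x₁ x] at h4
  rw [dist_eq_norm] at hd ⊢
  have e : NormedSpace.exp (t • hA.yosida m) x - NormedSpace.exp (t • hA.yosida n) x
      = NormedSpace.exp (t • hA.yosida m) (x - x₁)
        + (NormedSpace.exp (t • hA.yosida m) x₁ - NormedSpace.exp (t • hA.yosida n) x₁)
        + NormedSpace.exp (t • hA.yosida n) (x₁ - x) := by
    simp only [map_sub]; abel
  rw [e]
  refine (norm_add₃_le).trans_lt ?_
  have h5 : 0 ≤ ‖hA.yosida m x₁ - hA.yosida n x₁‖ := norm_nonneg _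
  change ‖hA.yosida m x₁ - hA.yosida n x₁‖ * _ < ε at h1
  nlinarith

/-- The semigroup generated by an m-dissipative operator. -/
def semigroup (hA : IsMDissipative A) (t : ℝ≥0) : X →L[ℂ] X :=
  continuousLinearMapOfTendsto (l := atTop) (fun n => NormedSpace.exp ((t : ℝ) • hA.yosida n))
    (f := fun x => (hA.exists_tendsto_exp_yosida t.2 x).choose)
    (tendsto_pi_nhds.2 fun x => (hA.exists_tendsto_exp_yosida t.2 x).choose_spec)

lemma tendsto_semigroup (hA : IsMDissipative A) (t : ℝ≥0) (x : X) :
    Tendsto (fun n => NormedSpace.exp ((t : ℝ) • hA.yosida n) x) atTop (𝓝 (hA.semigroup t x)) :=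
  (hA.exists_tendsto_exp_yosida t.2 x).choose_spec

lemma norm_semigroup_apply_le (hA : IsMDissipative A) (t : ℝ≥0) (x : X) :
    ‖hA.semigroup t x‖ ≤ ‖x‖ :=
  le_of_tendsto (hA.tendsto_semigroup t x).norm
    (Eventually.of_forall fun n => norm_exp_apply_le (hA.yosida_re_inner_nonpos n) t.2 x)

lemma norm_semigroup_le (hA : IsMDissipative A) (t : ℝ≥0) : ‖hA.semigroup t‖ ≤ 1 :=
  ContinuousLinearMap.opNorm_le_bound _ zero_le_one fun x => by
    rw [one_mul]; exact hA.norm_semigroup_apply_le t x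

lemma norm_semigroup_sub_self_le (hA : IsMDissipative A) (t : ℝ≥0) {x z : X}
    (h : (x, z) ∈ A.graph) : ‖hA.semigroup t x - x‖ ≤ ‖z‖ * t :=
  le_of_tendsto ((hA.tendsto_semigroup t x).sub_const x).norm
    (Eventually.of_forall fun n =>
      (norm_exp_sub_self_le (hA.yosida_re_inner_nonpos n) t.2 x).trans
        (mul_le_mul_of_nonneg_right (hA.norm_yosida_le n h) t.2))

/-- Limit of the bound for the Yosida exponentials: `‖Aₙ x - z‖` tends to zero and `‖Aₙ y‖ ≤ ‖y'‖`
uniformly. -/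
lemma norm_semigroup_sub_self_sub_smul_le (hA : IsMDissipative A) (t : ℝ≥0) {x z y y' : X}
    (h : (x, z) ∈ A.graph) (hy : (y, y') ∈ A.graph) :
    ‖hA.semigroup t x - x - (t : ℝ) • z‖ ≤ (2 * ‖z - y‖ + ‖y'‖ * t) * t := by
  have h1 := (((hA.tendsto_semigroup t x).sub_const x).sub_const ((t : ℝ) • z)).norm
  have h2 : Tendsto (fun n => (‖hA.yosida n x - z‖ + 2 * ‖z - y‖ + ‖y'‖ * t) * t) atTop
      (𝓝 ((‖z - z‖ + 2 * ‖z - y‖ + ‖y'‖ * t) * t)) :=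
    ((((hA.tendsto_yosida h).sub_const z).norm.add_const _).add_const _).mul_const _
  rw [sub_self, norm_zero, zero_add] at h2
  refine le_of_tendsto_of_tendsto h1 h2 (Eventually.of_forall fun n => ?_)
  refine (norm_exp_sub_self_sub_smul_le (t := (t : ℝ)) (hA.yosida_re_inner_nonpos n) t.2 x z
    y).trans ?_
  have h3 := mul_le_mul_of_nonneg_right (hA.norm_yosida_le n hy) t.coe_nonneg
  exact mul_le_mul_of_nonneg_right (by linarith) t.coe_nonneg

/-- The exponential law passes to the limit because the exponentials are uniformly contractive.
Strong continuity holds on the domain by the Lipschitz bound `‖S(t) x - x‖ ≤ t ‖A x‖`, and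
everywhere by density. -/
lemma isC0Semigroup (hA : IsMDissipative A) : IsC0Semigroup hA.semigroup where
  map_zero := by
    ext x
    exact tendsto_nhds_unique (hA.tendsto_semigroup 0 x) (by simp)
  map_add s t := by
    ext x
    refine tendsto_nhds_unique (hA.tendsto_semigroup (s + t) x) ?_
    have h1 := hA.tendsto_semigroup s (hA.semigroup t x)
    -- The inner argument also varies with `n`; contractivity of the outer exponential makes the
    -- resulting error vanish.
    have h2 : Tendsto (fun n => NormedSpace.exp ((s : ℝ) • hA.yosida n)
        (NormedSpace.exp ((t : ℝ) • hA.yosida n) x - hA.semigroup t x)) atTop (𝓝 0) := by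
      refine squeeze_zero_norm
        (fun n => norm_exp_apply_le (hA.yosida_re_inner_nonpos n) s.2 _) ?_
      simpa using ((hA.tendsto_semigroup t x).sub_const (hA.semigroup t x)).norm
    have h3 := h2.add h1
    rw [zero_add] at h3
    refine h3.congr fun n => ?_
    have e : NormedSpace.exp (((s + t : ℝ≥0) : ℝ) • hA.yosida n)
        = NormedSpace.exp ((s : ℝ) • hA.yosida n) * NormedSpace.exp ((t : ℝ) • hA.yosida n) := by
      let _ : NormedAlgebra ℚ (X →L[ℂ] X) := NormedAlgebra.restrictScalars ℚ ℂ _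
      rw [← NormedSpace.exp_add_of_commute, NNReal.coe_add, add_smul]
      exact ((Commute.refl _).smul_left _).smul_right _
    rw [e, map_sub, sub_add_cancel]
    rfl
  tendsto_zero x := by
    rw [Metric.tendsto_nhds]
    intro ε hε
    obtain ⟨x₁, hx₁, hd⟩ := hA.dense_domain.exists_dist_lt x (ε := ε / 4) (by positivity)
    have hg := A.mem_graph ⟨x₁, hx₁⟩
    set z := A ⟨x₁, hx₁⟩
    have hδ : ∀ᶠ t : ℝ≥0 in 𝓝[>] 0, ‖z‖ * (t : ℝ) < ε / 4 := by
      have h0 : Tendsto (fun t : ℝ≥0 => ‖z‖ * (t : ℝ)) (𝓝 0) (𝓝 (‖z‖ * ((0 : ℝ≥0) : ℝ))) :=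
        (continuous_const.mul NNReal.continuous_coe).tendsto 0
      rw [NNReal.coe_zero, mul_zero] at h0
      exact (h0.mono_left nhdsWithin_le_nhds).eventually_lt_const (by positivity)
    filter_upwards [hδ] with t ht
    rw [dist_eq_norm] at hd ⊢
    have e : hA.semigroup t x - x
        = hA.semigroup t (x - x₁) + (hA.semigroup t x₁ - x₁) + (x₁ - x) := by
      rw [map_sub]; abel
    rw [e]
    have h1 := hA.norm_semigroup_apply_le t (x - x₁)
    have h2 := hA.norm_semigroup_sub_self_le t hg
    have h3 : ‖x₁ - x‖ = ‖x - x₁‖ := norm_sub_rev _ _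
    refine (norm_add₃_le).trans_lt ?_
    linarith

/-- With `y` in the domain near `z`, the error of the quotient is at most `2 ‖z - y‖ + t ‖A y‖`: the
first term is small by density, the second for small `t`. -/
lemma tendsto_slope_semigroup (hA : IsMDissipative A) {x z : X} (h : (x, z) ∈ A.graph) :
    Tendsto (fun t : ℝ≥0 => (t : ℝ)⁻¹ • (hA.semigroup t x - x)) (𝓝[>] 0) (𝓝 z) := by
  rw [Metric.tendsto_nhds]
  intro ε hε
  obtain ⟨y, hy, hd⟩ := hA.dense_domain.exists_dist_lt z (ε := ε / 4) (by positivity)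
  have hg := A.mem_graph ⟨y, hy⟩
  set y' := A ⟨y, hy⟩
  have hδ : ∀ᶠ t : ℝ≥0 in 𝓝[>] 0, ‖y'‖ * (t : ℝ) < ε / 4 := by
    have h0 : Tendsto (fun t : ℝ≥0 => ‖y'‖ * (t : ℝ)) (𝓝 0) (𝓝 (‖y'‖ * ((0 : ℝ≥0) : ℝ))) :=
      (continuous_const.mul NNReal.continuous_coe).tendsto 0
    rw [NNReal.coe_zero, mul_zero] at h0
    exact (h0.mono_left nhdsWithin_le_nhds).eventually_lt_const (by positivity)
  filter_upwards [hδ, self_mem_nhdsWithin] with t ht ht0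
  have ht0' : (0 : ℝ) < t := ht0
  rw [dist_eq_norm] at hd ⊢
  have e : (t : ℝ)⁻¹ • (hA.semigroup t x - x) - z
      = (t : ℝ)⁻¹ • (hA.semigroup t x - x - (t : ℝ) • z) := by
    rw [smul_sub _ _ ((t : ℝ) • z), inv_smul_smul₀ ht0'.ne']
  rw [e, norm_smul, Real.norm_of_nonneg (by positivity), inv_mul_eq_div, div_lt_iff₀ ht0']
  refine (hA.norm_semigroup_sub_self_sub_smul_le t h hg).trans_lt ?_
  gcongr
  linarith

/-- For the converse inclusion, limits of difference quotients of a contraction semigroup are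
dissipative, and `A` has no proper dissipative extension since `1 - A` is onto. -/
lemma isGenerator (hA : IsMDissipative A) : IsGenerator A hA.semigroup := by
  refine fun x y => ⟨fun h => hA.tendsto_slope_semigroup h, fun h => ?_⟩
  -- `x'` solves `x' - A x' = x - y`. The quotients of `x - x'` then tend to `y - A x' = x - x'`, so
  -- dissipativity gives `‖x - x'‖² ≤ 0`.
  obtain ⟨x', hx'⟩ := hA.exists_mem_graph 1 one_pos (x - y)
  rw [Complex.ofReal_one, one_smul] at hx'
  have h1 := h.sub (hA.tendsto_slope_semigroup hx')
  have e : y - (x' - (x - y)) = x - x' := by abel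
  rw [e] at h1
  have h2 : (inner ℂ (x - x') (x - x')).re ≤ 0 := by
    have h3 := (Complex.continuous_re.tendsto _).comp 
      ((tendsto_const_nhds (x := x - x')).inner (𝕜 := ℂ) h1)
    refine le_of_tendsto h3 (Eventually.of_forall fun t => ?_)
    have e1 : (t : ℝ)⁻¹ • (hA.semigroup t x - x) - (t : ℝ)⁻¹ • (hA.semigroup t x' - x')
        = (((t : ℝ)⁻¹ : ℝ) : ℂ) • (hA.semigroup t (x - x') - (x - x')) := by
      rw [← smul_sub, map_sub, Complex.coe_smul]; congr 1; abel
    simp only [Function.comp, e1, inner_smul_right, Complex.re_ofReal_mul, inner_sub_right,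
      Complex.sub_re]
    refine mul_nonpos_of_nonneg_of_nonpos (by positivity) ?_
    have h4 : (inner ℂ (x - x') (x - x')).re = ‖x - x'‖ ^ 2 := inner_self_eq_norm_sq (𝕜 := ℂ) _
    have h5 : (inner ℂ (x - x') (hA.semigroup t (x - x'))).re ≤ ‖x - x'‖ * ‖x - x'‖ :=
      (re_inner_le_norm (𝕜 := ℂ) _ _).trans
        (mul_le_mul_of_nonneg_left (hA.norm_semigroup_apply_le t _) (norm_nonneg _))
    simp only [inner_sub_right, Complex.sub_re] at h4 ⊢
    linarith
  have h6 : x - x' = 0 := (re_inner_self_nonpos (𝕜 := ℂ)).1 h2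
  rw [sub_eq_zero] at h6
  subst h6
  simpa using hx'

/-! #### Classical solutions -/

/-- Contractivity reduces continuity from both sides at every time to right continuity at zero:
`‖S(t) x - S(s) x‖ ≤ ‖S(t - s) x - x‖` for `s ≤ t`. -/
lemma continuous_semigroup_apply (hA : IsMDissipative A) (x : X) :
    Continuous fun t : ℝ => hA.semigroup t.toNNReal x := by
  have hS := hA.isC0Semigroup
  suffices h : Continuous fun t : ℝ≥0 => hA.semigroup t x from h.comp continuous_real_toNNReal
  have key : ∀ s t : ℝ≥0, s ≤ t →
      ‖hA.semigroup t x - hA.semigroup s x‖ ≤ ‖hA.semigroup (t - s) x - x‖ := by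
    intro s t hst
    have e : hA.semigroup t x = hA.semigroup s (hA.semigroup (t - s) x) := by
      conv_lhs => rw [← add_tsub_cancel_of_le hst, hS.map_add]
      rfl
    rw [e, ← map_sub]
    exact hA.norm_semigroup_apply_le _ _
  rw [Metric.continuous_iff]
  intro t ε hε
  have h0 := (Metric.tendsto_nhds.1 (hS.tendsto_zero x)) ε hε
  rw [eventually_nhdsWithin_iff, Metric.eventually_nhds_iff] at h0
  obtain ⟨δ, hδ, h1⟩ := h0
  have h2 : ∀ r : ℝ≥0, (r : ℝ) < δ → ‖hA.semigroup r x - x‖ < ε := by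
    intro r hr
    rcases eq_or_ne r 0 with rfl | hr0
    · rw [hS.map_zero]; simpa using hε
    · rw [← dist_eq_norm]
      refine h1 ?_ (pos_iff_ne_zero.2 hr0)
      rw [NNReal.dist_eq, NNReal.coe_zero, sub_zero, abs_of_nonneg r.coe_nonneg]
      exact hr
  refine ⟨δ, hδ, fun s hs => ?_⟩
  rw [NNReal.dist_eq] at hs
  rcases le_total s t with hst | hst
  · rw [dist_comm, dist_eq_norm]
    refine (key s t hst).trans_lt (h2 _ ?_)
    rw [NNReal.coe_sub hst]
    rw [abs_sub_comm] at hs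
    exact (le_abs_self _).trans_lt hs
  · rw [dist_eq_norm]
    refine (key t s hst).trans_lt (h2 _ ?_)
    rw [NNReal.coe_sub hst]
    exact (le_abs_self _).trans_lt hs

/-- The domain is invariant under the semigroup, which commutes there with the operator. -/
lemma semigroup_mem_graph (hA : IsMDissipative A) (t : ℝ≥0) {x z : X} (h : (x, z) ∈ A.graph) :
    (hA.semigroup t x, hA.semigroup t z) ∈ A.graph := by
  have hS := hA.isC0Semigroup
  -- Membership in the graph is now a limit of difference quotients, and the bounded operator `S(t)`
  -- carries the quotients of `x` to those of `S(t) x`.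
  rw [hA.isGenerator]
  refine (((hA.semigroup t).continuous.tendsto z).comp (hA.tendsto_slope_semigroup h)).congr
    fun r => ?_
  have e : hA.semigroup t (hA.semigroup r x) = hA.semigroup r (hA.semigroup t x) := by
    have := congrArg (fun T : X →L[ℂ] X => T x) ((hS.map_add t r).symm.trans
      ((congrArg _ (add_comm t r)).trans (hS.map_add r t)))
    exact this
  simp only [Function.comp, ← e]
  rw [← Complex.coe_smul, map_smul, map_sub, Complex.coe_smul]

/-- The orbits of the semigroup starting in the domain are integrals of their velocities. -/
lemma semigroup_eq_integral (hA : IsMDissipative A) {x z : X} (h : (x, z) ∈ A.graph) {t : ℝ}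
    (ht : 0 ≤ t) :
    hA.semigroup t.toNNReal x = x + ∫ s in (0 : ℝ)..t, hA.semigroup s.toNNReal z := by
  have hS := hA.isC0Semigroup
  have hcz := hA.continuous_semigroup_apply z
  have hcx := hA.continuous_semigroup_apply x
  have hI : ∀ s, HasDerivAt (fun t => ∫ s in (0 : ℝ)..t, hA.semigroup s.toNNReal z)
      (hA.semigroup s.toNNReal z) s := fun s =>
    intervalIntegral.integral_hasDerivAt_right (hcz.intervalIntegrable _ _)
      (hcz.stronglyMeasurableAtFilter _ _) hcz.continuousAt
  have hR : ∀ s, 0 ≤ s → HasDerivWithinAt (fun t : ℝ => hA.semigroup t.toNNReal x)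
      (hA.semigroup s.toNNReal z) (Ici s) s := by
    intro s hs
    rw [← hasDerivWithinAt_Ioi_iff_Ici, hasDerivWithinAt_iff_tendsto_slope' self_notMem_Ioi]
    have h1 := hA.tendsto_slope_semigroup (hA.semigroup_mem_graph s.toNNReal h)
    have h2 : Tendsto (fun r : ℝ => (r - s).toNNReal) (𝓝[>] s) (𝓝[>] 0) := by
      refine tendsto_nhdsWithin_iff.2 ⟨?_, ?_⟩
      · have : Tendsto (fun r : ℝ => (r - s).toNNReal) (𝓝 s) (𝓝 (s - s).toNNReal) :=
          (continuous_real_toNNReal.comp (continuous_id.sub continuous_const)).tendsto s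
        rw [sub_self, Real.toNNReal_zero] at this
        exact this.mono_left nhdsWithin_le_nhds
      · filter_upwards [self_mem_nhdsWithin] with r hr
        exact Real.toNNReal_pos.2 (sub_pos.2 hr)
    refine (h1.comp h2).congr' ?_
    filter_upwards [self_mem_nhdsWithin] with r hr
    have hr' : 0 ≤ r - s := sub_nonneg.2 (le_of_lt hr)
    have e : hA.semigroup (r - s).toNNReal (hA.semigroup s.toNNReal x)
        = hA.semigroup r.toNNReal x := by
      have h3 : r.toNNReal = (r - s).toNNReal + s.toNNReal := by
        rw [← Real.toNNReal_add hr' hs, sub_add_cancel]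
      rw [h3, hS.map_add]
      rfl
    rw [Function.comp, e, Real.coe_toNNReal _ hr', slope_def_module]
  -- The semigroup law gives only right derivatives directly. They suffice: a continuous function
  -- with vanishing right derivative is constant.
  have h4 := constant_of_has_deriv_right_zero (a := 0) (b := t)
    (f := fun r : ℝ => hA.semigroup r.toNNReal x - ∫ s in (0 : ℝ)..r, hA.semigroup s.toNNReal z)
    (hcx.sub (continuous_iff_continuousAt.2 fun s => (hI s).continuousAt)).continuousOn
    (fun s hs => ((hR s hs.1).sub (hI s).hasDerivWithinAt).congr_deriv (sub_self _)) t (right_mem_Icc.2 ht)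
  simp only [Real.toNNReal_zero, hS.map_zero, intervalIntegral.integral_same, sub_zero] at h4
  rw [sub_eq_iff_eq_add] at h4
  exact h4

/-- The orbits of the semigroup starting in the domain are classical solutions, continuously
differentiable up to the initial time. -/
lemma isClassicalSolution_semigroup (hA : IsMDissipative A) {x : X} (hx : x ∈ A.domain) :
    IsClassicalSolution A x (fun t => hA.semigroup t.toNNReal x) ∧
      IsC1 (fun t : ℝ => hA.semigroup t.toNNReal x) := by
  have hg := A.mem_graph ⟨x, hx⟩
  set z := A ⟨x, hx⟩
  have hcz := hA.continuous_semigroup_apply z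
  -- `F` is continuously differentiable on the whole line, as its integrand is constant for negative
  -- times. It agrees with the orbit on `[0, ∞)`, which gives regularity up to zero and two-sided
  -- derivatives at positive times.
  set F : ℝ → X := fun t => x + ∫ s in (0 : ℝ)..t, hA.semigroup s.toNNReal z with hF
  have hI : ∀ s, HasDerivAt F (hA.semigroup s.toNNReal z) s := fun s =>
    (intervalIntegral.integral_hasDerivAt_right (hcz.intervalIntegrable _ _)
      (hcz.stronglyMeasurableAtFilter _ _) hcz.continuousAt).const_add x
  have hC : ContDiff ℝ 1 F := by
    rw [contDiff_one_iff_deriv]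
    refine ⟨fun s => (hI s).differentiableAt, ?_⟩
    rw [funext fun s => (hI s).deriv]
    exact hcz
  have hE : EqOn (fun t : ℝ => hA.semigroup t.toNNReal x) F (Ici 0) :=
    fun t ht => hA.semigroup_eq_integral hg ht
  have hC1 : IsC1 (fun t : ℝ => hA.semigroup t.toNNReal x) := hC.contDiffOn.congr hE
  refine ⟨⟨?_, (hA.continuous_semigroup_apply x).continuousOn, hC1.mono Ioi_subset_Ici_self,
    fun t ht => ?_⟩, hC1⟩
  · simp [hA.isC0Semigroup.map_zero]
  · obtain ⟨y, hy, hy'⟩ :=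
      (LinearPMap.mem_graph_iff A).1 (hA.semigroup_mem_graph t.toNNReal hg)
    have hy1 : (y : X) = hA.semigroup t.toNNReal x := hy
    have hy2 : A y = hA.semigroup t.toNNReal z := hy'
    refine ⟨hy1 ▸ y.2, ?_⟩
    have e : A ⟨hA.semigroup t.toNNReal x, hy1 ▸ y.2⟩ = hA.semigroup t.toNNReal z := by
      rw [← hy2]
      congr 1
      exact Subtype.ext hy1.symm
    rw [e]
    exact (hI t).congr_of_eventuallyEq (hE.eventuallyEq_of_mem (Ici_mem_nhds ht))

end IsMDissipative

end Generation

/-! ### Primitives and weak derivatives -/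

section Weak

variable {a b : ℝ}

lemma iteratedDeriv_add_eq (m n : ℕ) (φ : ℝ → ℝ) :
    iteratedDeriv (m + n) φ = iteratedDeriv m (iteratedDeriv n φ) := by
  rw [iteratedDeriv_eq_iterate, iteratedDeriv_eq_iterate, iteratedDeriv_eq_iterate,
    Function.iterate_add_apply]

lemma IsWeakDeriv.comp {m n : ℕ} {f g h : L2 a b} (hfg : IsWeakDeriv m f g)
    (hgh : IsWeakDeriv n g h) : IsWeakDeriv (m + n) f h := by
  intro φ hφ
  rw [iteratedDeriv_add_eq, hfg _ (hφ.iteratedDeriv n), hgh φ hφ, pow_add, mul_assoc]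

/-- Test functions `φ⁽ⁿ⁾` are admissible in the relation between `f` and `g`. This turns the second
weak derivative of `u`, as provided by the Sobolev space, into the weak derivative of `u'`. -/
lemma IsWeakDeriv.of_comp {m n : ℕ} {f g h : L2 a b} (hfg : IsWeakDeriv m f g)
    (hfh : IsWeakDeriv (m + n) f h) : IsWeakDeriv n g h := by
  intro φ hφ
  have h1 := hfh φ hφ
  rw [iteratedDeriv_add_eq, hfg _ (hφ.iteratedDeriv n), pow_add, mul_assoc] at h1
  exact mul_left_cancel₀ (pow_ne_zero m (by norm_num)) h1

lemma isWeakDeriv_zero (f : L2 a b) : IsWeakDeriv 0 f f := fun φ _ => by simp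

lemma HasTrace.unique (hab : a < b) {x : ℝ} (hx : x ∈ Icc a b) {f : L2 a b} {c d : ℂ}
    (hc : HasTrace f x c) (hd : HasTrace f x d) : c = d := by
  have h1 := hc.add (hd.smul (-1))
  rw [neg_one_smul, add_neg_cancel] at h1
  have h2 := h1.eq_of_ae_const (d := 0) hab hx (Lp.coeFn_zero ℂ 2 _)
  linear_combination h2

lemma IsTest.eq_zero {φ : ℝ → ℝ} (h : IsTest a b φ) {x : ℝ} (hx : x ∉ Ioo a b) : φ x = 0 :=
  image_eq_zero_of_notMem_tsupport fun h' => hx (h.2.2 h')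

lemma IsTest.deriv {φ : ℝ → ℝ} (h : IsTest a b φ) : IsTest a b (deriv φ) := by
  simpa using h.iteratedDeriv 1

lemma IsTest.hasDerivAt {φ : ℝ → ℝ} (h : IsTest a b φ) (x : ℝ) :
    HasDerivAt φ (_root_.deriv φ x) x :=
  (h.1.differentiable (by simp) x).hasDerivAt

lemma IsTest.integral_deriv {φ : ℝ → ℝ} (h : IsTest a b φ) :
    ∫ x in Ioo a b, _root_.deriv φ x = 0 := by
  rw [setIntegral_eq_integral_of_forall_compl_eq_zero fun x hx => h.deriv.eq_zero hx]
  exact integral_eq_zero_of_hasDerivAt_of_integrable h.hasDerivAt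
    (h.deriv.1.continuous.integrable_of_hasCompactSupport h.deriv.2.1)
    (h.1.continuous.integrable_of_hasCompactSupport h.2.1)

lemma IsTest.mul {φ ψ : ℝ → ℝ} (h : IsTest a b φ) (h' : IsTest a b ψ) :
    IsTest a b (fun x => φ x * ψ x) :=
  ⟨h.1.mul h'.1, h.2.1.mul_right,
    (closure_mono (Function.support_mul_subset_left φ ψ)).trans h.2.2⟩

/-- The integral of a square integrable function over the part of the interval up to `x`. -/
def primitive (f : L2 a b) (x : ℝ) : ℂ := ∫ t in a..x, f t ∂(volume.restrict (Ioo a b))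

lemma continuous_primitive (f : L2 a b) : Continuous (primitive f) :=
  intervalIntegral.continuous_primitive (fun _ _ => f.integrable.intervalIntegrable) a

lemma primitive_left (f : L2 a b) : primitive f a = 0 := intervalIntegral.integral_same

/-- As an inner product with an indicator, the primitive is visibly linear in `f`, and
Cauchy–Schwarz bounds it. -/
lemma primitive_eq_inner (f : L2 a b) {x : ℝ} (hx : a ≤ x) :
    primitive f x = inner ℂ (indicatorConstLp 2 (measurableSet_Ioc (a := a) (b := x))
      (measure_ne_top (volume.restrict (Ioo a b)) _) (1 : ℂ)) f := by
  rw [L2.inner_indicatorConstLp_one, primitive, intervalIntegral.integral_of_le hx]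

lemma norm_primitive_le (f : L2 a b) {x : ℝ} (hx : a ≤ x) :
    ‖primitive f x‖ ≤ (volume.restrict (Ioo a b)).real univ ^ (1 / (2 : ℝ)) * ‖f‖ := by
  rw [primitive_eq_inner f hx]
  refine (norm_inner_le_norm _ _).trans ?_
  gcongr
  refine norm_indicatorConstLp_le.trans ?_
  rw [norm_one, one_mul, ENNReal.toReal_ofNat]
  exact Real.rpow_le_rpow measureReal_nonneg (measureReal_mono (subset_univ _)) (by norm_num)

lemma memLp_primitive (f : L2 a b) : MemLp (primitive f) 2 (volume.restrict (Ioo a b)) := by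
  refine MemLp.of_bound (continuous_primitive f).aestronglyMeasurable
    ((volume.restrict (Ioo a b)).real univ ^ (1 / (2 : ℝ)) * ‖f‖) ?_
  filter_upwards [ae_restrict_mem measurableSet_Ioo] with x hx
  exact norm_primitive_le f hx.1.le

variable (a b) in
/-- The Volterra operator, which takes a function to its primitive vanishing at the left end
point. -/
def volterra : L2 a b →L[ℂ] L2 a b :=
  LinearMap.mkContinuous
    { toFun := fun f => (memLp_primitive f).toLp
      map_add' := fun f g => by
        rw [← MemLp.toLp_add]
        refine MemLp.toLp_congr _ _ ?_
        filter_upwards [ae_restrict_mem measurableSet_Ioo] with x hx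
        simp only [Pi.add_apply, primitive_eq_inner _ hx.1.le, inner_add_right]
      map_smul' := fun c f => by
        rw [RingHom.id_apply, ← MemLp.toLp_const_smul]
        refine MemLp.toLp_congr _ _ ?_
        filter_upwards [ae_restrict_mem measurableSet_Ioo] with x hx
        simp only [Pi.smul_apply, primitive_eq_inner _ hx.1.le, inner_smul_right, smul_eq_mul] }
    (measureUnivNNReal (volume.restrict (Ioo a b)) ^ (2 : ENNReal).toReal⁻¹ *
      (volume.restrict (Ioo a b)).real univ ^ (1 / (2 : ℝ)))
    fun f => by
      rw [mul_assoc]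
      refine Lp.norm_le_of_ae_bound (by positivity) ?_
      filter_upwards [(memLp_primitive f).coeFn_toLp, ae_restrict_mem measurableSet_Ioo]
        with x hx hx'
      simp only [LinearMap.coe_mk, AddHom.coe_mk]
      rw [hx]
      exact norm_primitive_le f hx'.1.le

lemma coeFn_volterra (f : L2 a b) :
    volterra a b f =ᵐ[volume.restrict (Ioo a b)] primitive f :=
  (memLp_primitive f).coeFn_toLp

lemma hasTrace_volterra (f : L2 a b) (x : ℝ) : HasTrace (volterra a b f) x (primitive f x) :=
  ⟨primitive f, (continuous_primitive f).continuousOn, coeFn_volterra f, rfl⟩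

variable (a b) in
/-- The integral over the whole interval. -/
def total : L2 a b →L[ℂ] ℂ :=
  innerSL ℂ (indicatorConstLp 2 (measurableSet_Ioc (a := a) (b := b))
      (measure_ne_top (volume.restrict (Ioo a b)) _) (1 : ℂ))

lemma primitive_right (hab : a < b) (f : L2 a b) : primitive f b = total a b f :=
  primitive_eq_inner f hab.le

variable (a b) in
/-- The embedding of the constants. -/
def constant : ℂ →L[ℂ] L2 a b := Lp.constL 2 (volume.restrict (Ioo a b)) ℂ

lemma coeFn_constant (c : ℂ) :
    constant a b c =ᵐ[volume.restrict (Ioo a b)] fun _ => c :=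
  Lp.coeFn_const _ _ _

lemma hasTrace_constant (c : ℂ) (x : ℝ) : HasTrace (constant a b c) x c :=
  ⟨fun _ => c, continuousOn_const, coeFn_constant c, rfl⟩

/-- The primitive of a function has that function as its weak derivative. -/
lemma isWeakDeriv_volterra (g : L2 a b) : IsWeakDeriv 1 (volterra a b g) g := by
  intro φ hφ
  set μ := volume.restrict (Ioo a b) with hμ
  have hφ' := hφ.deriv.1.continuous
  rw [iteratedDeriv_one]
  have hint : Integrable (deriv φ) μ :=
    (hφ'.integrable_of_hasCompactSupport hφ.2.1.deriv).integrableOn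
  -- Fubini on the triangle `t ≤ x`: the double integral of `φ'(x) g(t)` is computed in both orders.
  set S : Set (ℝ × ℝ) := {p | p.2 ≤ p.1} with hS
  have hSm : MeasurableSet S := measurableSet_le measurable_snd measurable_fst
  set F : ℝ → ℝ → ℂ := fun x t => S.indicator (fun p => deriv φ p.1 • g p.2) (x, t) with hF
  have hFi : Integrable (Function.uncurry F) (μ.prod μ) :=
    (hint.smul_prod g.integrable).indicator hSm
  have e1 : ∫ x, deriv φ x • volterra a b g x ∂μ = ∫ x, ∫ t, F x t ∂μ ∂μ := by
    refine integral_congr_ae ?_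
    filter_upwards [coeFn_volterra g, ae_restrict_mem measurableSet_Ioo] with x hx hx'
    have e : (fun t => F x t) = (Iic x).indicator fun t => deriv φ x • g t := by
      funext t
      simp only [hF, hS, indicator, mem_ofPred_eq, mem_Iic]
    rw [hx, e, integral_indicator measurableSet_Iic, integral_smul, primitive,
      intervalIntegral.integral_of_le hx'.1.le, hμ, Measure.restrict_restrict measurableSet_Ioc,
      Measure.restrict_restrict measurableSet_Iic]
    congr 3
    ext t
    simp only [mem_inter_iff, mem_Ioc, mem_Iic, mem_Ioo]
    tauto
  -- Integrating `φ'` from `t` to `b` gives `-φ t`, because `φ` vanishes at `b`.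
  have e2 : ∫ t, ∫ x, F x t ∂μ ∂μ = ∫ t, -(φ t • g t) ∂μ := by
    refine integral_congr_ae ?_
    filter_upwards [ae_restrict_mem measurableSet_Ioo] with t ht
    have e : (fun x => F x t) = (Ici t).indicator fun x => deriv φ x • g t := by
      funext x
      simp only [hF, hS, indicator, mem_ofPred_eq, mem_Ici]
    have h1 : Ici t ∩ Ioo a b = Ico t b := by
      ext x
      simp only [mem_inter_iff, mem_Ici, mem_Ioo, mem_Ico]
      exact ⟨fun h => ⟨h.1, h.2.2⟩, fun h => ⟨h.1, ht.1.trans_le h.1, h.2⟩⟩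
    have h2 : φ b = 0 := image_eq_zero_of_notMem_tsupport fun h => (hφ.2.2 h).2.false
    rw [e, integral_indicator measurableSet_Ici, integral_smul_const, hμ,
      Measure.restrict_restrict measurableSet_Ici, h1, integral_Ico_eq_integral_Ioo,
      ← integral_Ioc_eq_integral_Ioo, ← intervalIntegral.integral_of_le ht.2.le,
      intervalIntegral.integral_eq_sub_of_hasDerivAt (fun x _ => hφ.hasDerivAt x)
        (hφ'.intervalIntegrable _ _), h2, zero_sub, neg_smul]
  rw [e1, integral_integral_swap hFi, e2, integral_neg, pow_one, neg_one_mul]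

lemma isWeakDeriv_constant (c : ℂ) : IsWeakDeriv 1 (constant a b c) 0 := by
  intro φ hφ
  rw [iteratedDeriv_one]
  have e1 : ∫ x in Ioo a b, deriv φ x • constant a b c x = ∫ x in Ioo a b, deriv φ x • c := by
    refine integral_congr_ae ?_
    filter_upwards [coeFn_constant c] with x hx
    rw [hx]
  have e2 : ∫ x in Ioo a b, φ x • (0 : L2 a b) x = 0 := by
    refine integral_eq_zero_of_ae ?_
    filter_upwards [Lp.coeFn_zero ℂ 2 (volume.restrict (Ioo a b))] with x hx
    rw [hx, Pi.zero_apply, smul_zero]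
  rw [e1, e2, integral_smul_const, hφ.integral_deriv, zero_smul, mul_zero]

/-- A function with weak derivative `g` is a primitive of `g`. -/
lemma IsWeakDeriv.exists_eq_volterra (hab : a < b) {f g : L2 a b} (h : IsWeakDeriv 1 f g) :
    ∃ c, f = constant a b c + volterra a b g := by
  have h1 := h.add ((isWeakDeriv_volterra g).smul (-1))
  rw [neg_one_smul, neg_one_smul, add_neg_cancel] at h1
  obtain ⟨c, hc⟩ := ae_const_of_isWeakDeriv_zero hab h1
  have h2 : f + -volterra a b g = constant a b c := Lp.ext (hc.trans (coeFn_constant c).symm)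
  exact ⟨c, by rw [← h2]; abel⟩

lemma IsWeakDeriv.eq_volterra_of_left (hab : a < b) {f g : L2 a b} {c : ℂ}
    (h : IsWeakDeriv 1 f g) (hc : HasTrace f a c) : f = constant a b c + volterra a b g := by
  obtain ⟨d, rfl⟩ := h.exists_eq_volterra hab
  have h1 := hc.unique hab (left_mem_Icc.2 hab.le)
    ((hasTrace_constant d a).add (hasTrace_volterra g a))
  rw [primitive_left, add_zero] at h1
  rw [h1]

lemma hasTrace_right_volterra (hab : a < b) (g : L2 a b) (c : ℂ) :
    HasTrace (constant a b c + volterra a b g) b (c + total a b g) := by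
  rw [← primitive_right hab]
  exact (hasTrace_constant c b).add (hasTrace_volterra g b)

lemma hasTrace_left_volterra (g : L2 a b) (c : ℂ) :
    HasTrace (constant a b c + volterra a b g) a c := by
  simpa [primitive_left] using (hasTrace_constant c a).add (hasTrace_volterra g a)

variable (a b) in
/-- The operator which takes a function to its primitive vanishing at the right end point. -/
def volterraRight : L2 a b →L[ℂ] L2 a b :=
  volterra a b - constant a b ∘L total a b

lemma volterraRight_apply (g : L2 a b) :
    volterraRight a b g = constant a b (-total a b g) + volterra a b g := by
  rw [map_neg, neg_add_eq_sub]; rfl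

lemma isWeakDeriv_volterraRight (g : L2 a b) : IsWeakDeriv 1 (volterraRight a b g) g := by
  rw [volterraRight_apply]
  simpa using (isWeakDeriv_constant (-total a b g)).add (isWeakDeriv_volterra g)

lemma IsWeakDeriv.eq_volterraRight (hab : a < b) {f g : L2 a b}
    (h : IsWeakDeriv 1 f g) (hc : HasTrace f b 0) : f = volterraRight a b g := by
  obtain ⟨d, rfl⟩ := h.exists_eq_volterra hab
  have h1 := hc.unique hab (right_mem_Icc.2 hab.le) (hasTrace_right_volterra hab g d)
  rw [volterraRight_apply, eq_neg_of_add_eq_zero_left h1.symm]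

lemma hasTrace_right_volterraRight (hab : a < b) (g : L2 a b) :
    HasTrace (volterraRight a b g) b 0 := by
  rw [volterraRight_apply]
  simpa using hasTrace_right_volterra hab g (-total a b g)

lemma hasTrace_left_volterraRight (g : L2 a b) :
    HasTrace (volterraRight a b g) a (-total a b g) := by
  rw [volterraRight_apply]
  exact hasTrace_left_volterra g _

/-! ### Test functions as elements of the Lebesgue space -/

lemma IsTest.memLp {φ : ℝ → ℝ} (h : IsTest a b φ) :
    MemLp (fun x => (φ x : ℂ)) 2 (volume.restrict (Ioo a b)) := by
  obtain ⟨C, hC⟩ := h.1.continuous.bounded_above_of_compact_support h.2.1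
  exact MemLp.of_bound (Complex.continuous_ofReal.comp h.1.continuous).aestronglyMeasurable C
    (ae_of_all _ fun x => by simpa using hC x)

/-- A test function as an element of the complex Lebesgue space. -/
def IsTest.toL2 {φ : ℝ → ℝ} (h : IsTest a b φ) : L2 a b := h.memLp.toLp

lemma IsTest.inner_toL2 {φ : ℝ → ℝ} (h : IsTest a b φ) (f : L2 a b) :
    inner ℂ h.toL2 f = ∫ x in Ioo a b, φ x • f x := by
  rw [L2.inner_def]
  refine integral_congr_ae ?_
  filter_upwards [h.memLp.coeFn_toLp] with x hx
  rw [IsTest.toL2, hx]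
  simp [mul_comm]

/-- This is the form in which the variational equation, tested with test functions, delivers weak
derivatives. -/
lemma isWeakDeriv_iff_inner {n : ℕ} {f g : L2 a b} :
    IsWeakDeriv n f g ↔ ∀ (φ : ℝ → ℝ) (h : IsTest a b φ),
      inner ℂ (h.iteratedDeriv n).toL2 f = (-1) ^ n * inner ℂ h.toL2 g := by
  simp only [IsTest.inner_toL2]
  rfl

lemma IsTest.hasTrace_toL2 {φ : ℝ → ℝ} (h : IsTest a b φ) {x : ℝ} (hx : x ∉ Ioo a b) :
    HasTrace h.toL2 x 0 :=
  ⟨fun x => (φ x : ℂ), (Complex.continuous_ofReal.comp h.1.continuous).continuousOn,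
    h.memLp.coeFn_toLp, by simp [h.eq_zero hx]⟩

/-- Integration by parts: `(ψ φ)'` is the derivative of a test function and has integral zero. -/
lemma IsTest.isWeakDeriv_toL2_one {φ : ℝ → ℝ} (h : IsTest a b φ) :
    IsWeakDeriv 1 h.toL2 (h.iteratedDeriv 1).toL2 := by
  intro ψ hψ
  have key : ∫ x in Ioo a b, _root_.deriv ψ x * φ x
      = -∫ x in Ioo a b, ψ x * _root_.deriv φ x := by
    have h0 := (hψ.mul h).integral_deriv
    have hi : ∀ {χ : ℝ → ℝ}, IsTest a b χ → Integrable χ (volume.restrict (Ioo a b)) :=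
      fun hχ => (hχ.1.continuous.integrable_of_hasCompactSupport hχ.2.1).integrableOn
    have hd : _root_.deriv (fun x => ψ x * φ x)
        = fun x => _root_.deriv ψ x * φ x + ψ x * _root_.deriv φ x :=
      funext fun x => ((hψ.hasDerivAt x).mul (h.hasDerivAt x)).deriv
    rw [hd,
      integral_add (hi (hψ.deriv.mul h)) (hi (hψ.mul h.deriv))] at h0
    exact eq_neg_of_add_eq_zero_left h0
  have e : ∀ {χ ξ : ℝ → ℝ} (hχ : IsTest a b χ), ∫ x in Ioo a b, ξ x • hχ.toL2 x
      = ((∫ x in Ioo a b, ξ x * χ x : ℝ) : ℂ) := by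
    intro χ ξ hχ
    rw [← integral_complex_ofReal]
    refine integral_congr_ae ?_
    filter_upwards [hχ.memLp.coeFn_toLp] with x hx
    rw [IsTest.toL2, hx]
    simp
  rw [e, e, iteratedDeriv_one, iteratedDeriv_one, key]
  simp

lemma IsTest.isWeakDeriv_toL2_two {φ : ℝ → ℝ} (h : IsTest a b φ) :
    IsWeakDeriv 2 h.toL2 (h.iteratedDeriv 2).toL2 := by
  have h1 := h.isWeakDeriv_toL2_one.comp (h.iteratedDeriv 1).isWeakDeriv_toL2_one
  have e : _root_.iteratedDeriv 1 (_root_.iteratedDeriv 1 φ) = _root_.iteratedDeriv 2 φ :=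
    (iteratedDeriv_add_eq 1 1 φ).symm
  have e' : ((h.iteratedDeriv 1).iteratedDeriv 1).toL2 = (h.iteratedDeriv 2).toL2 := by
    unfold IsTest.toL2
    congr 1
    simp only [e]
  rwa [e'] at h1

end Weak

/-! ### The displacement space is a Hilbert space -/

namespace Disp

variable {G : Geometry}

/-! ### Recovering a displacement from its strains `(u'', v', w'')`. -/

lemma isWeakDeriv_u_one (Y : Disp G) : IsWeakDeriv 1 (u Y) (weakDeriv 1 (u Y)) :=
  weakDeriv_spec ((u_mem Y).1 1 (by norm_num))

lemma isWeakDeriv_u_two (Y : Disp G) : IsWeakDeriv 2 (u Y) (weakDeriv 2 (u Y)) :=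
  weakDeriv_spec ((u_mem Y).1 2 le_rfl)

lemma isWeakDeriv_v_one (Y : Disp G) : IsWeakDeriv 1 (v Y) (weakDeriv 1 (v Y)) :=
  weakDeriv_spec (v_mem Y 1 le_rfl)

lemma isWeakDeriv_w_one (Y : Disp G) : IsWeakDeriv 1 (w Y) (weakDeriv 1 (w Y)) :=
  weakDeriv_spec ((w_mem Y).1 1 (by norm_num))

lemma isWeakDeriv_w_two (Y : Disp G) : IsWeakDeriv 2 (w Y) (weakDeriv 2 (w Y)) :=
  weakDeriv_spec ((w_mem Y).1 2 le_rfl)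

lemma isWeakDeriv_deriv_u (Y : Disp G) :
    IsWeakDeriv 1 (weakDeriv 1 (u Y)) (weakDeriv 2 (u Y)) :=
  (isWeakDeriv_u_one Y).of_comp (isWeakDeriv_u_two Y)

lemma isWeakDeriv_deriv_w (Y : Disp G) :
    IsWeakDeriv 1 (weakDeriv 1 (w Y)) (weakDeriv 2 (w Y)) :=
  (isWeakDeriv_w_one Y).of_comp (isWeakDeriv_w_two Y)

/-- The clamped end kills the constant of integration. The same holds for `u`, and for the right
beam when integrating from `l₃`. -/
lemma deriv_u_eq (Y : Disp G) :
    weakDeriv 1 (u Y) = volterra G.l₀ G.l₁ (weakDeriv 2 (u Y)) := by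
  simpa using (isWeakDeriv_deriv_u Y).eq_volterra_of_left G.h₀₁ (u_mem Y).2.2

lemma u_eq (Y : Disp G) : u Y = volterra G.l₀ G.l₁ (weakDeriv 1 (u Y)) := by
  simpa using (isWeakDeriv_u_one Y).eq_volterra_of_left G.h₀₁ (u_mem Y).2.1

lemma deriv_w_eq (Y : Disp G) :
    weakDeriv 1 (w Y) = volterraRight G.l₂ G.l₃ (weakDeriv 2 (w Y)) :=
  (isWeakDeriv_deriv_w Y).eq_volterraRight G.h₂₃ (w_mem Y).2.2

lemma w_eq (Y : Disp G) : w Y = volterraRight G.l₂ G.l₃ (weakDeriv 1 (w Y)) :=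
  (isWeakDeriv_w_one Y).eq_volterraRight G.h₂₃ (w_mem Y).2.1

lemma hasTrace_u (Y : Disp G) : HasTrace (u Y) G.l₁ (total G.l₀ G.l₁ (weakDeriv 1 (u Y))) := by
  rw [← primitive_right G.h₀₁]
  conv => enter [1]; rw [u_eq Y]
  exact hasTrace_volterra _ _

lemma hasTrace_w (Y : Disp G) :
    HasTrace (w Y) G.l₂ (-total G.l₂ G.l₃ (weakDeriv 1 (w Y))) := by
  conv => enter [1]; rw [w_eq Y]
  exact hasTrace_left_volterraRight _

/-- The string has no boundary condition of its own; continuity at `l₁` fixes its constant as the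
end value of the left beam. -/
lemma v_eq (Y : Disp G) : v Y = constant G.l₁ G.l₂ (total G.l₀ G.l₁ (weakDeriv 1 (u Y)))
    + volterra G.l₁ G.l₂ (weakDeriv 1 (v Y)) := by
  obtain ⟨c, c1, c2⟩ := Y.2.2.2.2.1
  have h := c1.unique G.h₀₁ (right_mem_Icc.2 G.h₀₁.le) (hasTrace_u Y)
  rw [← h]
  exact (isWeakDeriv_v_one Y).eq_volterra_of_left G.h₁₂ c2

/-- Continuity at `l₂`, the one condition not used up by constants of integration. It becomes a
scalar constraint on the strains. -/
lemma total_deriv_v (Y : Disp G) : total G.l₀ G.l₁ (weakDeriv 1 (u Y))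
    + total G.l₁ G.l₂ (weakDeriv 1 (v Y)) + total G.l₂ G.l₃ (weakDeriv 1 (w Y)) = 0 := by
  obtain ⟨c, c1, c2⟩ := Y.2.2.2.2.2
  have h1 := c2.unique G.h₂₃ (left_mem_Icc.2 G.h₂₃.le) (hasTrace_w Y)
  have h2 := hasTrace_right_volterra G.h₁₂ (weakDeriv 1 (v Y))
    (total G.l₀ G.l₁ (weakDeriv 1 (u Y)))
  rw [← v_eq Y] at h2
  have h3 := h2.unique G.h₁₂ (right_mem_Icc.2 G.h₁₂.le) c1
  rw [h3, h1, neg_add_cancel]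

lemma inner_eq (Y Z : Disp G) : inner ℂ Y Z = inner ℂ (weakDeriv 2 (u Y)) (weakDeriv 2 (u Z))
    + inner ℂ (weakDeriv 1 (v Y)) (weakDeriv 1 (v Z))
    + inner ℂ (weakDeriv 2 (w Y)) (weakDeriv 2 (w Z)) := rfl

variable (G) in
/-- The isometric map which takes a displacement to `(u'', v', w'')`. -/
def strain : Disp G →ₗᵢ[ℂ] Vel G :=
  LinearMap.isometryOfInner
    { toFun := fun Y => Vel.mk (weakDeriv 2 (u Y)) (weakDeriv 1 (v Y)) (weakDeriv 2 (w Y))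
      map_add' := fun Y Z => by
        rw [map_add, map_add, map_add,
          weakDeriv_add ⟨_, isWeakDeriv_u_two Y⟩ ⟨_, isWeakDeriv_u_two Z⟩,
          weakDeriv_add ⟨_, isWeakDeriv_v_one Y⟩ ⟨_, isWeakDeriv_v_one Z⟩,
          weakDeriv_add ⟨_, isWeakDeriv_w_two Y⟩ ⟨_, isWeakDeriv_w_two Z⟩]
        rfl
      map_smul' := fun c Y => by
        rw [map_smul, map_smul, map_smul, weakDeriv_smul c ⟨_, isWeakDeriv_u_two Y⟩,
          weakDeriv_smul c ⟨_, isWeakDeriv_v_one Y⟩, weakDeriv_smul c ⟨_, isWeakDeriv_w_two Y⟩]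
        rfl }
    fun Y Z => by
      rw [inner_eq, add_assoc]
      simp only [LinearMap.coe_mk, AddHom.coe_mk, Vel.mk, WithLp.prod_inner_apply]

lemma strain_apply (Y : Disp G) :
    strain G Y = Vel.mk (weakDeriv 2 (u Y)) (weakDeriv 1 (v Y)) (weakDeriv 2 (w Y)) := rfl

lemma volterra_volterra_mem_clamped {a b : ℝ} (p : L2 a b) :
    volterra a b (volterra a b p) ∈ clamped a b a := by
  have h1 := isWeakDeriv_volterra (volterra a b p)
  refine ⟨fun n hn => ?_, ?_, ?_⟩
  · interval_cases n
    · exact ⟨_, isWeakDeriv_zero _⟩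
    · exact ⟨_, h1⟩
    · exact ⟨_, h1.comp (isWeakDeriv_volterra p)⟩
  · simpa using hasTrace_left_volterra (volterra a b p) 0
  · rw [h1.weakDeriv_eq]
    simpa using hasTrace_left_volterra p 0

lemma volterraRight_volterraRight_mem_clamped {a b : ℝ} (hab : a < b) (p : L2 a b) :
    volterraRight a b (volterraRight a b p) ∈ clamped a b b := by
  have h1 := isWeakDeriv_volterraRight (volterraRight a b p)
  refine ⟨fun n hn => ?_, hasTrace_right_volterraRight hab _, ?_⟩
  · interval_cases n
    · exact ⟨_, isWeakDeriv_zero _⟩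
    · exact ⟨_, h1⟩
    · exact ⟨_, h1.comp (isWeakDeriv_volterraRight p)⟩
  · rw [h1.weakDeriv_eq]
    exact hasTrace_right_volterraRight hab _

/-- The constraint is the only one: any strains satisfying it integrate up, inwards from the clamped
ends and across the string, to an admissible displacement. -/
lemma range_strain : range (strain G) = {z : Vel G |
    total G.l₀ G.l₁ (volterra G.l₀ G.l₁ z.fst) + total G.l₁ G.l₂ z.snd.fst
      + total G.l₂ G.l₃ (volterraRight G.l₂ G.l₃ z.snd.snd) = 0} := by
  ext z
  constructor
  · rintro ⟨Y, rfl⟩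
    have h := total_deriv_v Y
    rw [deriv_u_eq, deriv_w_eq] at h
    exact h
  · intro hz
    have hz' : total G.l₀ G.l₁ (volterra G.l₀ G.l₁ z.fst) + total G.l₁ G.l₂ z.snd.fst
      + total G.l₂ G.l₃ (volterraRight G.l₂ G.l₃ z.snd.snd) = 0 := hz
    have hu := (isWeakDeriv_volterra (volterra G.l₀ G.l₁ z.fst)).comp (isWeakDeriv_volterra z.fst)
    have hw := (isWeakDeriv_volterraRight (volterraRight G.l₂ G.l₃ z.snd.snd)).comp
      (isWeakDeriv_volterraRight z.snd.snd)
    have hv := (isWeakDeriv_constant (a := G.l₁) (b := G.l₂)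
      (total G.l₀ G.l₁ (volterra G.l₀ G.l₁ z.fst))).add (isWeakDeriv_volterra z.snd.fst)
    rw [zero_add] at hv
    let Y : Disp G := ⟨(volterra G.l₀ G.l₁ (volterra G.l₀ G.l₁ z.fst),
      constant G.l₁ G.l₂ (total G.l₀ G.l₁ (volterra G.l₀ G.l₁ z.fst))
        + volterra G.l₁ G.l₂ z.snd.fst,
      volterraRight G.l₂ G.l₃ (volterraRight G.l₂ G.l₃ z.snd.snd)),
      volterra_volterra_mem_clamped _, fun n hn => by
        interval_cases n
        · exact ⟨_, isWeakDeriv_zero _⟩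
        · exact ⟨_, hv⟩,
      volterraRight_volterraRight_mem_clamped G.h₂₃ _,
      ⟨_, by simpa using hasTrace_right_volterra G.h₀₁ (volterra G.l₀ G.l₁ z.fst) 0,
        hasTrace_left_volterra _ _⟩,
      ⟨_, hasTrace_right_volterra G.h₁₂ _ _, by
        rw [eq_neg_of_add_eq_zero_left hz']
        exact hasTrace_left_volterraRight _⟩⟩
    refine ⟨Y, ?_⟩
    have eu : weakDeriv 2 (u Y) = z.fst := hu.weakDeriv_eq
    have ev : weakDeriv 1 (v Y) = z.snd.fst := hv.weakDeriv_eq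
    have ew : weakDeriv 2 (w Y) = z.snd.snd := hw.weakDeriv_eq
    rw [strain_apply, eu, ev, ew]
    rfl

/-- `ℍ` is isometric to the zero set of a continuous functional on the complete space `𝕃`. -/
instance : CompleteSpace (Disp G) := by
  refine (completeSpace_iff_isComplete_range
    (strain G).isometry.isUniformInducing).2 (IsClosed.isComplete ?_)
  rw [range_strain]
  refine isClosed_eq ?_ continuous_const
  fun_prop

/-! #### The components of a displacement as bounded operators -/

variable (G) in
/-- `u''` as a bounded operator. -/
def curvatureU : Disp G →L[ℂ] L2 G.l₀ G.l₁ :=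
  WithLp.fstL 2 ℂ _ _ ∘L (strain G).toContinuousLinearMap

variable (G) in
/-- `v'` as a bounded operator. -/
def slopeV : Disp G →L[ℂ] L2 G.l₁ G.l₂ :=
  WithLp.fstL 2 ℂ _ _ ∘L WithLp.sndL 2 ℂ _ _ ∘L (strain G).toContinuousLinearMap

variable (G) in
/-- `w''` as a bounded operator. -/
def curvatureW : Disp G →L[ℂ] L2 G.l₂ G.l₃ :=
  WithLp.sndL 2 ℂ _ _ ∘L WithLp.sndL 2 ℂ _ _ ∘L (strain G).toContinuousLinearMap

variable (G) in
/-- `u'` as a bounded operator. -/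
def slopeU : Disp G →L[ℂ] L2 G.l₀ G.l₁ := volterra G.l₀ G.l₁ ∘L curvatureU G

variable (G) in
/-- `w'` as a bounded operator. -/
def slopeW : Disp G →L[ℂ] L2 G.l₂ G.l₃ := volterraRight G.l₂ G.l₃ ∘L curvatureW G

variable (G) in
/-- `u` as a bounded operator. -/
def uL : Disp G →L[ℂ] L2 G.l₀ G.l₁ := volterra G.l₀ G.l₁ ∘L slopeU G

variable (G) in
/-- `v` as a bounded operator. -/
def vL : Disp G →L[ℂ] L2 G.l₁ G.l₂ :=
  constant G.l₁ G.l₂ ∘L total G.l₀ G.l₁ ∘L slopeU G + volterra G.l₁ G.l₂ ∘L slopeV G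

variable (G) in
/-- `w` as a bounded operator. -/
def wL : Disp G →L[ℂ] L2 G.l₂ G.l₃ := volterraRight G.l₂ G.l₃ ∘L slopeW G

lemma slopeU_apply (Y : Disp G) : slopeU G Y = weakDeriv 1 (u Y) := (deriv_u_eq Y).symm

lemma slopeW_apply (Y : Disp G) : slopeW G Y = weakDeriv 1 (w Y) := (deriv_w_eq Y).symm

lemma uL_apply (Y : Disp G) : uL G Y = u Y := by
  rw [u_eq Y, ← slopeU_apply]; rfl

lemma vL_apply (Y : Disp G) : vL G Y = v Y := by
  rw [v_eq Y, ← slopeU_apply]; rfl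

lemma wL_apply (Y : Disp G) : wL G Y = w Y := by
  rw [w_eq Y, ← slopeW_apply]; rfl

/-! #### Displacements given by test functions -/

/-- A test function on the left beam as a displacement. -/
def ofTestU {φ : ℝ → ℝ} (h : IsTest G.l₀ G.l₁ φ) : Disp G :=
  ⟨(h.toL2, 0, 0), ⟨fun n hn => by
      interval_cases n
      · exact ⟨_, isWeakDeriv_zero _⟩
      · exact ⟨_, h.isWeakDeriv_toL2_one⟩
      · exact ⟨_, h.isWeakDeriv_toL2_two⟩,
    h.hasTrace_toL2 (by simp), by
      rw [h.isWeakDeriv_toL2_one.weakDeriv_eq]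
      exact (h.iteratedDeriv 1).hasTrace_toL2 (by simp)⟩,
    zero_mem _, zero_mem _, ⟨0, h.hasTrace_toL2 (by simp), hasTrace_zero _⟩,
    ⟨0, hasTrace_zero _, hasTrace_zero _⟩⟩

/-- A test function on the string as a displacement. -/
def ofTestV {φ : ℝ → ℝ} (h : IsTest G.l₁ G.l₂ φ) : Disp G :=
  ⟨(0, h.toL2, 0), zero_mem _, fun n hn => by
      interval_cases n
      · exact ⟨_, isWeakDeriv_zero _⟩
      · exact ⟨_, h.isWeakDeriv_toL2_one⟩,
    zero_mem _, ⟨0, hasTrace_zero _, h.hasTrace_toL2 (by simp)⟩,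
    ⟨0, h.hasTrace_toL2 (by simp), hasTrace_zero _⟩⟩

/-- A test function on the right beam as a displacement. -/
def ofTestW {φ : ℝ → ℝ} (h : IsTest G.l₂ G.l₃ φ) : Disp G :=
  ⟨(0, 0, h.toL2), zero_mem _, zero_mem _, ⟨fun n hn => by
      interval_cases n
      · exact ⟨_, isWeakDeriv_zero _⟩
      · exact ⟨_, h.isWeakDeriv_toL2_one⟩
      · exact ⟨_, h.isWeakDeriv_toL2_two⟩,
    h.hasTrace_toL2 (by simp), by
      rw [h.isWeakDeriv_toL2_one.weakDeriv_eq]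
      exact (h.iteratedDeriv 1).hasTrace_toL2 (by simp)⟩,
    ⟨0, hasTrace_zero _, hasTrace_zero _⟩, ⟨0, hasTrace_zero _, h.hasTrace_toL2 (by simp)⟩⟩

end Disp

/-! ### The operator of the system is m-dissipative -/

section System

open ContinuousLinearMap Disp

variable {G : Geometry}

lemma inner_mk (Y Y' : Disp G) (f f' : L2 G.l₀ G.l₁) (g g' : L2 G.l₁ G.l₂) (h h' : L2 G.l₂ G.l₃) :
    inner ℂ (EnergySpace.mk Y (Vel.mk f g h)) (EnergySpace.mk Y' (Vel.mk f' g' h'))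
      = inner ℂ Y Y' + (inner ℂ f f' + (inner ℂ g g' + inner ℂ h h')) := by
  simp only [EnergySpace.mk, Vel.mk, WithLp.prod_inner_apply]

lemma mem_graph_systemOp {ρ₁ ρ₂ β : ℝ} {U : Disp G × Disp G} (hU : U ∈ domPairs G ρ₁ ρ₂ β) :
    (incl G U, matrixOp ρ₁ ρ₂ β U) ∈ (systemOp G ρ₁ ρ₂ β).graph := by
  rw [← systemOp_apply G ρ₁ ρ₂ β U hU]
  exact LinearPMap.mem_graph (systemOp G ρ₁ ρ₂ β) ⟨incl G U, Submodule.mem_map_of_mem hU⟩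

lemma exists_of_mem_graph_systemOp {ρ₁ ρ₂ β : ℝ} {p : EnergySpace G × EnergySpace G}
    (hp : p ∈ (systemOp G ρ₁ ρ₂ β).graph) :
    ∃ U ∈ domPairs G ρ₁ ρ₂ β, p = (incl G U, matrixOp ρ₁ ρ₂ β U) := by
  obtain ⟨⟨x, hx⟩, h1, h2⟩ := (LinearPMap.mem_graph_iff (systemOp G ρ₁ ρ₂ β)).1 hp
  obtain ⟨U, hU, rfl⟩ := hx
  refine ⟨U, hU, Prod.ext h1.symm ?_⟩
  rw [← h2]
  exact systemOp_apply G ρ₁ ρ₂ β U hU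

/-- The energy does not increase. -/
lemma re_aForm_self_nonpos {ρ₁ ρ₂ β : ℝ} (hρ₁ : 0 ≤ ρ₁) (hρ₂ : 0 ≤ ρ₂) (hβ : 0 ≤ β)
    (U : Disp G × Disp G) : (aForm ρ₁ ρ₂ β U U).re ≤ 0 := by
  have h : ∀ {a b : ℝ} (f g : L2 a b), (inner ℂ f g).re = (inner ℂ g f).re :=
    fun {a b} f g => inner_re_symm (𝕜 := ℂ) (E := L2 a b) f g
  have hn : ∀ {a b : ℝ} (r : ℝ) (f : L2 a b), 0 ≤ r → 0 ≤ r * (inner ℂ f f).re :=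
    fun r f hr => mul_nonneg hr (inner_self_nonneg (𝕜 := ℂ) (x := f))
  simp only [aForm, Complex.add_re, Complex.sub_re, Complex.re_ofReal_mul]
  -- The elastic terms occur in pairs `⟨f, g⟩ - ⟨g, f⟩`, whose real part vanishes; only the damping
  -- terms remain.
  rw [h (weakDeriv 2 (u U.1)) (weakDeriv 2 (u U.2)), h (weakDeriv 1 (v U.1)) (weakDeriv 1 (v U.2)),
    h (weakDeriv 2 (w U.1)) (weakDeriv 2 (w U.2))]
  linarith [hn ρ₁ (weakDeriv 1 (u U.2)) hρ₁, hn β (v U.2) hβ, hn ρ₂ (weakDeriv 1 (w U.2)) hρ₂]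

/-! ### Solvability of the resolvent equation. -/

variable (G) in
/-- The Gram operator of the form `c ⟨Y, Z⟩_𝕃 + ρ₁ ⟨u', ũ'⟩ + β ⟨v, ṽ⟩ + ρ₂ ⟨w', w̃'⟩` on `ℍ`. -/
def dampingOp (c ρ₁ ρ₂ β : ℝ) : Disp G →L[ℂ] Disp G :=
  (c : ℂ) • (adjoint (uL G) ∘L uL G + adjoint (vL G) ∘L vL G + adjoint (wL G) ∘L wL G)
    + (ρ₁ : ℂ) • (adjoint (slopeU G) ∘L slopeU G) + (β : ℂ) • (adjoint (vL G) ∘L vL G)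
    + (ρ₂ : ℂ) • (adjoint (slopeW G) ∘L slopeW G)

lemma inner_dampingOp (c ρ₁ ρ₂ β : ℝ) (Z Y : Disp G) :
    inner ℂ Z (dampingOp G c ρ₁ ρ₂ β Y)
      = c * (inner ℂ (u Z) (u Y) + inner ℂ (v Z) (v Y) + inner ℂ (w Z) (w Y))
        + ρ₁ * inner ℂ (weakDeriv 1 (u Z)) (weakDeriv 1 (u Y)) + β * inner ℂ (v Z) (v Y)
        + ρ₂ * inner ℂ (weakDeriv 1 (w Z)) (weakDeriv 1 (w Y)) := by
  simp only [dampingOp, add_apply, smul_apply, comp_apply, inner_add_right,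
    inner_smul_right, adjoint_inner_right, uL_apply, vL_apply, wL_apply, slopeU_apply,
    slopeW_apply]

/-- Lax–Milgram: the damping form is nonnegative, so `Re ⟨Y, (1 + c P) Y⟩ ≥ ‖Y‖²`, where `P` is the
damping operator. -/
lemma isUnit_one_add_dampingOp {c ρ₁ ρ₂ β : ℝ} (hc : 0 ≤ c) (hρ₁ : 0 ≤ ρ₁) (hρ₂ : 0 ≤ ρ₂)
    (hβ : 0 ≤ β) : IsUnit (1 + (c : ℂ) • dampingOp G c ρ₁ ρ₂ β) := by
  refine isUnit_of_forall_le_norm_inner_map _ (c := 1) one_pos fun Y => ?_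
  rw [NNReal.coe_one, mul_one, norm_inner_symm]
  refine le_trans ?_ (Complex.re_le_norm _)
  have hn : ∀ {a b : ℝ} (f : L2 a b), 0 ≤ (inner ℂ f f).re :=
    fun f => inner_self_nonneg (𝕜 := ℂ) (x := f)
  have h1 : (inner ℂ Y Y).re = ‖Y‖ ^ 2 := inner_self_eq_norm_sq (𝕜 := ℂ) Y
  have h0 : (1 : Disp G →L[ℂ] Disp G) Y = Y := rfl
  simp only [add_apply, h0, smul_apply, inner_add_right, inner_smul_right, inner_dampingOp,
    Complex.add_re, Complex.re_ofReal_mul, h1]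
  have h2 := hn (u Y)
  have h3 := hn (v Y)
  have h4 := hn (w Y)
  have h5 := hn (weakDeriv 1 (u Y))
  have h6 := hn (weakDeriv 1 (w Y))
  rw [le_add_iff_nonneg_right]
  positivity

/-- The variational form of the resolvent equation is solvable. -/
lemma exists_variational_solution {c ρ₁ ρ₂ β : ℝ} (hc : 0 ≤ c) (hρ₁ : 0 ≤ ρ₁) (hρ₂ : 0 ≤ ρ₂)
    (hβ : 0 ≤ β) (F : Disp G) (f : L2 G.l₀ G.l₁) (g : L2 G.l₁ G.l₂) (h : L2 G.l₂ G.l₃) :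
    ∃ Y₁ Y₂ : Disp G, Y₂ = (c : ℂ) • Y₁ - F ∧ ∀ Z : Disp G,
      inner ℂ Z Y₁ + (c * (inner ℂ (u Z) (u Y₂) + inner ℂ (v Z) (v Y₂) + inner ℂ (w Z) (w Y₂))
        + ρ₁ * inner ℂ (weakDeriv 1 (u Z)) (weakDeriv 1 (u Y₂)) + β * inner ℂ (v Z) (v Y₂)
        + ρ₂ * inner ℂ (weakDeriv 1 (w Z)) (weakDeriv 1 (w Y₂)))
      = inner ℂ (u Z) f + inner ℂ (v Z) g + inner ℂ (w Z) h := by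
  set P := dampingOp G c ρ₁ ρ₂ β
  obtain ⟨T, hT⟩ := (isUnit_one_add_dampingOp (G := G) hc hρ₁ hρ₂ hβ).exists_right_inv
  -- The equation for `Y₁` is `Y₁ + P (c Y₁ - F) = R - P F`, with the adjoints representing the data
  -- `f, g, h`. Moving `P F` to the right makes the operator `1 + c P`.
  set R : Disp G := adjoint (uL G) f + adjoint (vL G) g + adjoint (wL G) h + P F with hR
  refine ⟨T R, (c : ℂ) • T R - F, rfl, fun Z => ?_⟩
  have h1 : T R + (c : ℂ) • P (T R) = R := congrArg (fun S : Disp G →L[ℂ] Disp G => S R) hT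
  have h2 : T R + P ((c : ℂ) • T R - F)
      = adjoint (uL G) f + adjoint (vL G) g + adjoint (wL G) h := by
    rw [map_sub, map_smul, ← add_sub_assoc, h1, hR, add_sub_cancel_right]
  have h3 := congrArg (fun S => inner ℂ Z S) h2
  simp only [inner_add_right, adjoint_inner_right, uL_apply, vL_apply, wL_apply] at h3
  rw [inner_dampingOp] at h3
  exact h3

lemma inner_ofTestU {φ : ℝ → ℝ} (h : IsTest G.l₀ G.l₁ φ) (Y : Disp G) :
    inner ℂ (ofTestU h) Y = inner ℂ (h.iteratedDeriv 2).toL2 (weakDeriv 2 (u Y)) := by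
  have e1 : u (ofTestU h) = h.toL2 := rfl
  have e2 : v (ofTestU h) = 0 := rfl
  have e3 : w (ofTestU h) = 0 := rfl
  rw [inner_eq, e1, e2, e3, h.isWeakDeriv_toL2_two.weakDeriv_eq,
    (isWeakDeriv_zero_zero 1).weakDeriv_eq, (isWeakDeriv_zero_zero 2).weakDeriv_eq,
    inner_zero_left, inner_zero_left, add_zero, add_zero]

lemma inner_ofTestV {φ : ℝ → ℝ} (h : IsTest G.l₁ G.l₂ φ) (Y : Disp G) :
    inner ℂ (ofTestV h) Y = inner ℂ (h.iteratedDeriv 1).toL2 (weakDeriv 1 (v Y)) := by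
  have e1 : u (ofTestV h) = 0 := rfl
  have e2 : v (ofTestV h) = h.toL2 := rfl
  have e3 : w (ofTestV h) = 0 := rfl
  rw [inner_eq, e1, e2, e3, h.isWeakDeriv_toL2_one.weakDeriv_eq,
    (isWeakDeriv_zero_zero 2).weakDeriv_eq, (isWeakDeriv_zero_zero 2).weakDeriv_eq,
    inner_zero_left, inner_zero_left, zero_add, add_zero]

lemma inner_ofTestW {φ : ℝ → ℝ} (h : IsTest G.l₂ G.l₃ φ) (Y : Disp G) :
    inner ℂ (ofTestW h) Y = inner ℂ (h.iteratedDeriv 2).toL2 (weakDeriv 2 (w Y)) := by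
  have e1 : u (ofTestW h) = 0 := rfl
  have e2 : v (ofTestW h) = 0 := rfl
  have e3 : w (ofTestW h) = h.toL2 := rfl
  rw [inner_eq, e1, e2, e3, h.isWeakDeriv_toL2_two.weakDeriv_eq,
    (isWeakDeriv_zero_zero 1).weakDeriv_eq, (isWeakDeriv_zero_zero 2).weakDeriv_eq,
    inner_zero_left, inner_zero_left, zero_add, zero_add]

/-- A variational solution is regular and solves the resolvent equation. -/
lemma exists_resolvent_solution {c ρ₁ ρ₂ β : ℝ} (hc : 0 ≤ c) (hρ₁ : 0 ≤ ρ₁) (hρ₂ : 0 ≤ ρ₂)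
    (hβ : 0 ≤ β) (F : EnergySpace G) :
    ∃ U ∈ domPairs G ρ₁ ρ₂ β, matrixOp ρ₁ ρ₂ β U = (c : ℂ) • incl G U - F := by
  obtain ⟨Y₁, Y₂, hY, hvar⟩ := exists_variational_solution hc hρ₁ hρ₂ hβ F.fst F.snd.fst
    F.snd.snd.fst F.snd.snd.snd
  have hu : IsWeakDeriv 2 (weakDeriv 2 (u Y₁))
      (F.snd.fst - (c : ℂ) • u Y₂ + (ρ₁ : ℂ) • weakDeriv 2 (u Y₂)) := by
    refine isWeakDeriv_iff_inner.2 fun φ h => ?_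
    -- A test function in one component isolates the equation on that interval. The term `ρ₁ ⟨φ',
    -- u₂'⟩` becomes `-ρ₁ ⟨φ, u₂''⟩`, so `u₁''` has a square integrable second weak derivative.
    have h1 := hvar (ofTestU h)
    have h2 := isWeakDeriv_iff_inner.1 (isWeakDeriv_deriv_u Y₂) φ h
    have e1 : u (ofTestU h) = h.toL2 := rfl
    have e2 : v (ofTestU h) = 0 := rfl
    have e3 : w (ofTestU h) = 0 := rfl
    rw [inner_ofTestU, e1, e2, e3, h.isWeakDeriv_toL2_one.weakDeriv_eq, h2,
      (isWeakDeriv_zero_zero 1).weakDeriv_eq] at h1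
    simp only [inner_zero_left] at h1
    simp only [inner_add_right, inner_sub_right, inner_smul_right]
    linear_combination h1
  have hv : IsWeakDeriv 1 (weakDeriv 1 (v Y₁))
      (((c : ℂ) + (β : ℂ)) • v Y₂ - F.snd.snd.fst) := by
    refine isWeakDeriv_iff_inner.2 fun φ h => ?_
    have h1 := hvar (ofTestV h)
    have e1 : u (ofTestV h) = 0 := rfl
    have e2 : v (ofTestV h) = h.toL2 := rfl
    have e3 : w (ofTestV h) = 0 := rfl
    rw [inner_ofTestV, e1, e2, e3, (isWeakDeriv_zero_zero 1).weakDeriv_eq,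
      (isWeakDeriv_zero_zero 1).weakDeriv_eq] at h1
    simp only [inner_zero_left] at h1
    simp only [inner_sub_right, inner_smul_right]
    linear_combination h1
  have hw : IsWeakDeriv 2 (weakDeriv 2 (w Y₁))
      (F.snd.snd.snd - (c : ℂ) • w Y₂ + (ρ₂ : ℂ) • weakDeriv 2 (w Y₂)) := by
    refine isWeakDeriv_iff_inner.2 fun φ h => ?_
    have h1 := hvar (ofTestW h)
    have h2 := isWeakDeriv_iff_inner.1 (isWeakDeriv_deriv_w Y₂) φ h
    have e1 : u (ofTestW h) = 0 := rfl
    have e2 : v (ofTestW h) = 0 := rfl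
    have e3 : w (ofTestW h) = h.toL2 := rfl
    rw [inner_ofTestW, e1, e2, e3, h.isWeakDeriv_toL2_one.weakDeriv_eq, h2,
      (isWeakDeriv_zero_zero 1).weakDeriv_eq] at h1
    simp only [inner_zero_left] at h1
    simp only [inner_add_right, inner_sub_right, inner_smul_right]
    linear_combination h1
  have hu4 := (isWeakDeriv_u_two Y₁).comp hu
  have hv2 := (isWeakDeriv_v_one Y₁).comp hv
  have hw4 := (isWeakDeriv_w_two Y₁).comp hw
  -- Inserting these derivatives cancels the damping terms and leaves the velocity half of the
  -- resolvent equation; the displacement half is `hY`.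
  have hmat : matrixOp ρ₁ ρ₂ β (Y₁, Y₂) = EnergySpace.mk Y₂ (Vel.mk
      ((c : ℂ) • u Y₂ - F.snd.fst) ((c : ℂ) • v Y₂ - F.snd.snd.fst)
      ((c : ℂ) • w Y₂ - F.snd.snd.snd)) := by
    have e1 := hu4.weakDeriv_eq
    have e2 := hv2.weakDeriv_eq
    have e3 := hw4.weakDeriv_eq
    norm_num at e1 e2 e3
    simp only [matrixOp, e1, e2, e3]
    congr 2
    · module
    · module
    · module
  refine ⟨(Y₁, Y₂), ⟨⟨⟨_, hu4⟩, ⟨_, hv2⟩, ⟨_, hw4⟩⟩, fun V => ?_⟩, ?_⟩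
  -- The transmission conditions are natural boundary conditions: they are the variational equation
  -- for arbitrary `V.2`, not only for test functions. The terms in `V.1` agree on both sides.
  · have h1 := hvar V.2
    have e : incl G V = EnergySpace.mk V.1 (Vel.mk (u V.2) (v V.2) (w V.2)) := rfl
    rw [hmat, e, inner_mk, inner_eq]
    rw [inner_eq] at h1
    simp only [aForm, inner_sub_right, inner_smul_right]
    linear_combination h1
  · rw [hmat, hY]
    rfl

/-- Testing the weak transmission condition with `V = U` identifies `⟨AU, U⟩` with the form, whose
real part is nonpositive; surjectivity is the solved resolvent equation. -/
lemma isMDissipative_systemOp {ρ₁ ρ₂ β : ℝ} (hρ₁ : 0 ≤ ρ₁) (hρ₂ : 0 ≤ ρ₂) (hβ : 0 ≤ β) :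
    IsMDissipative (systemOp G ρ₁ ρ₂ β) where
  re_inner_nonpos p hp := by
    obtain ⟨U, hU, rfl⟩ := exists_of_mem_graph_systemOp hp
    rw [hU.2 U]
    exact re_aForm_self_nonpos hρ₁ hρ₂ hβ U
  exists_mem_graph c hc F := by
    obtain ⟨U, hU, h⟩ := exists_resolvent_solution hc.le hρ₁ hρ₂ hβ F
    exact ⟨incl G U, h ▸ mem_graph_systemOp hU⟩

end System

end BeamString

end

theorem theorem3p1 (G : BeamString.Geometry) (ρ₁ ρ₂ β : ℝ) (hρ₁ : 0 ≤ ρ₁) (hρ₂ : 0 ≤ ρ₂)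
    (hβ : 0 ≤ β) :
    CompleteSpace (BeamString.EnergySpace G) ∧
    ∃ S : ℝ≥0 → BeamString.EnergySpace G →L[ℂ] BeamString.EnergySpace G,
      BeamString.IsC0Semigroup S ∧ (∀ t, ‖S t‖ ≤ 1) ∧
      BeamString.IsGenerator (BeamString.systemOp G ρ₁ ρ₂ β) S ∧
      (∀ U₀ ∈ (BeamString.systemOp G ρ₁ ρ₂ β).domain,
        ∃ U : ℝ → BeamString.EnergySpace G,
          BeamString.IsClassicalSolution (BeamString.systemOp G ρ₁ ρ₂ β) U₀ U ∧
          BeamString.IsC1 U ∧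
          (∀ t : ℝ≥0, U t = S t U₀) ∧
          ∀ V : ℝ → BeamString.EnergySpace G,
            BeamString.IsClassicalSolution (BeamString.systemOp G ρ₁ ρ₂ β) U₀ V →
              EqOn V U (Ici 0)) ∧
      (∀ U₀ ∈ (BeamString.systemOp G ρ₁ ρ₂ β).domain,
        ∀ V₀ ∈ (BeamString.systemOp G ρ₁ ρ₂ β).domain,
        ∀ U V : ℝ → BeamString.EnergySpace G,
          BeamString.IsClassicalSolution (BeamString.systemOp G ρ₁ ρ₂ β) U₀ U →
          BeamString.IsClassicalSolution (BeamString.systemOp G ρ₁ ρ₂ β) V₀ V →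
            ∀ t : ℝ, 0 ≤ t → ‖U t - V t‖ ≤ ‖U₀ - V₀‖) := by
  have hA := BeamString.isMDissipative_systemOp (G := G) hρ₁ hρ₂ hβ
  refine ⟨inferInstance, hA.semigroup, hA.isC0Semigroup, hA.norm_semigroup_le, hA.isGenerator,
    fun U₀ hU₀ => ?_, fun U₀ _ V₀ _ U V hU hV t ht => hA.norm_sub_le hU hV ht⟩
  obtain ⟨h1, h2⟩ := hA.isClassicalSolution_semigroup hU₀
  refine ⟨_, h1, h2, fun t => by rw [Real.toNNReal_coe], fun V hV t ht => ?_⟩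
  -- Uniqueness is the contraction estimate for equal initial values.
  have h3 := hA.norm_sub_le hV h1 ht
  rw [sub_self, norm_zero] at h3
  exact sub_eq_zero.1 (norm_le_zero_iff.1 h3)
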